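/- **Setting.** Let $a<b$, $0<T<\infty$, and let $\rho_0:[a,b]\to(0,\infty)$ be smooth with $\rho_0'(a)=\rho_0'(b)=0$. Let $M_0\subset\mathbb{R}^3$ be the surface generated by rotating the graph of $\rho_0$ about the $x_1$-axis, and let $\Omega=[a,b]\times S^1$. Let $\mathbf{x}:\Omega\times[0,T)\to\mathbb{R}^3$, $\mathbf{x}((l,\omega),t)=(z(l,t),\,r(l,t)\,\omega)$, be a smooth axially symmetric solution of the volume preserving mean curvature flow $$\frac{d}{dt}\mathbf{x}=-(H-h)\,\nu\quad(0<t<T),\qquad h(t)=\frac{\int_{M_t}H\,dg_t}{\int_{M_t}dg_t},$$ where $M_t=\mathbf{x}(\Omega,t)$, with $z(l,0)=l$ and $r(l,0)=\rho_0(l)$, such that each $M_t$ ($t<T$) is generated by the graph of a positive radius function on $[a,b]$ and meets the planes $x_1=a$ and $x_1=b$ orthogonally along its boundary: $r>0$, $\partial_l z>0$, $z(a,t)=a$, $z(b,t)=b$, and $\partial_l r=0$ at $l=a,b$. (Here $z,r$ are smooth on $[a,b]\times(0,T)$, and together with their first two $l$-derivatives they are continuous on $[a,b]\times[0,T)$.)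 Here $\nu$ is the unit normal pointing away from the axis; $k$ and $p$ are the principal curvatures of $M_t$ in the direction of the generating curve and in the rotational direction (for the graph of $\rho$: $k=-\rho''/(1+\rho'^2)^{3/2}$ and $p=1/(\rho\sqrt{1+\rho'^2})$); $H=k+p$, $|A|^2=k^2+p^2$; and $y=r$ is the distance to the axis of rotation. For a constant $c_2>0$ (for instance a positive lower bound of $h$ on $[0,T)$) let $$\hat\Omega'=\{(m,t)\in\Omega\times[0,T): H(m,t)>c_2/2\}.$$ For $S\subset\Omega\times[0,T)$ put $S_t=\{m:(m,t)\in S\}$, and let the parabolic boundary $\Gamma_S$ be the topological boundary of $S$ in $\Omega\times\mathbb{R}$ without its points at time $T$. We say that the singularity develops in $S$ if $|A|$ is unbounded on $S$ as $t\to T$, that is, if for all $K$ and all $t_0<T$ there is $(m,t)\in S$ with $t_0<t<T$ and $|A|^2(m,t)>K$. **Proposition.** Let $S\subset\hat\Omega'$ and suppose that there are constants $c_{12},c_{13}>0$ such that $$\frac{|A|^2}{H^2}\le c_{12}\ \text{ on } S\qquad\text{and}\qquad y\ge c_{13}\ \text{ on }\Gamma_S .$$ If the singularity develops in $S$, then there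 is a constant $C>0$ such that $$\max_{S_t}|A|^2\le\frac{C}{T-t}\qquad\text{for all } t<T,$$ that is, $|A|^2(m,t)\le C/(T-t)$ for all $t\in[0,T)$ and all $m\in S_t$. -/

import Mathlib

open Set

open scoped ContDiff

noncomputable section

namespace AxialFlow

/-- The parameter manifold: the annulus `[a, b] × S¹`. A point of spacetime is a pair
`((l, w), t)`. -/
abbrev Param (a b : ℝ) : Type := Icc a b × Circle

/-- Derivative of `f (l, t)` in the profile parameter `l ∈ [a, b]` (one-sided at the ends). -/
def dl (a b : ℝ) (f : ℝ → ℝ → ℝ) (l t : ℝ) : ℝ :=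
  derivWithin (fun s => f s t) (Icc a b) l

/-- The position vector `𝐱((l, w), t) = (z, r w) ∈ ℝ × ℝ² = ℝ³` of the surface obtained by rotating
the profile curve `l ↦ (z (l, t), r (l, t))` about the `x₁`-axis. The height function `y`
(the distance from the axis of rotation) is `r`. -/
def position (z r : ℝ → ℝ → ℝ) (l : ℝ) (w : Circle) (t : ℝ) : EuclideanSpace ℝ (Fin 3) :=
  !₂[z l t, r l t * (w : ℂ).re, r l t * (w : ℂ).im]

/-- The length of `∂𝐱/∂l`. -/
def speed (a b : ℝ) (z r : ℝ → ℝ → ℝ) (l t : ℝ) : ℝ :=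
  Real.sqrt (dl a b z l t ^ 2 + dl a b r l t ^ 2)

/-- The unit normal `ν`; it points away from the axis of rotation where `∂z/∂l > 0`. -/
def unitNormal (a b : ℝ) (z r : ℝ → ℝ → ℝ) (l : ℝ) (w : Circle) (t : ℝ) :
    EuclideanSpace ℝ (Fin 3) :=
  (speed a b z r l t)⁻¹ •
    !₂[-dl a b r l t, dl a b z l t * (w : ℂ).re, dl a b z l t * (w : ℂ).im]

/-- The rotational principal curvature `p = ⟨τ₁, i₁⟩ / y`, where `τ₁` is the unit tangent vector of
the profile curve; for a graph `z = l`, `r = ρ` it is `1 / (ρ √(1 + ρ'²))`. -/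
def curvP (a b : ℝ) (z r : ℝ → ℝ → ℝ) (l t : ℝ) : ℝ :=
  dl a b z l t / speed a b z r l t / r l t

/-- The principal curvature `k = ⟨∇_{τ₁} ν, τ₁⟩` in the direction of the profile curve; for a graph
`z = l`, `r = ρ` it is `-ρ'' / (1 + ρ'²) ^ (3/2)`. -/
def curvK (a b : ℝ) (z r : ℝ → ℝ → ℝ) (l t : ℝ) : ℝ :=
  (dl a b (dl a b z) l t * dl a b r l t - dl a b z l t * dl a b (dl a b r) l t) /
    speed a b z r l t ^ 3

/-- The mean curvature `H = k + p`. -/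
def meanCurv (a b : ℝ) (z r : ℝ → ℝ → ℝ) (l t : ℝ) : ℝ :=
  curvK a b z r l t + curvP a b z r l t

/-- The squared norm `|A|² = k² + p²` of the second fundamental form. -/
def normASq (a b : ℝ) (z r : ℝ → ℝ → ℝ) (l t : ℝ) : ℝ :=
  curvK a b z r l t ^ 2 + curvP a b z r l t ^ 2

/-- The area density of the surface with respect to `dl`: the area element is
`r |∂𝐱/∂l| dl dθ`, already integrated over the angle `θ`. -/
def areaDensity (a b : ℝ) (z r : ℝ → ℝ → ℝ) (l t : ℝ) : ℝ :=
  2 * Real.pi * r l t * speed a b z r l t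

/-- The average `h(t) = ∫ H dg / ∫ dg` of the mean curvature over the surface at time `t`. -/
def avgMeanCurv (a b : ℝ) (z r : ℝ → ℝ → ℝ) (t : ℝ) : ℝ :=
  (∫ l in a..b, meanCurv a b z r l t * areaDensity a b z r l t) /
    ∫ l in a..b, areaDensity a b z r l t

/-- `(z, r)` describes a smooth solution on `[0, T)` of the volume preserving mean curvature flow
`d𝐱/dt = -(H - h) ν` of axially symmetric surfaces in `ℝ³` between the planes `x₁ = a` and
`x₁ = b`, which meet both planes orthogonally, starting from the surface generated by the graph of
`ρ₀`. For positive times the solution is smooth up to the boundary planes. At time `0` it attains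
its initial value together with the first two derivatives in `l`; more is not available for a smooth
`ρ₀` with `ρ₀' = 0` at `a` and `b`, since no compatibility of higher order is required of `ρ₀`. -/
structure IsFlow (a b T : ℝ) (ρ₀ : ℝ → ℝ) (z r : ℝ → ℝ → ℝ) : Prop where
  smooth_z : ContDiffOn ℝ ∞ (Function.uncurry z) (Icc a b ×ˢ Ioo 0 T)
  smooth_r : ContDiffOn ℝ ∞ (Function.uncurry r) (Icc a b ×ˢ Ioo 0 T)
  cont_z : ContinuousOn (Function.uncurry z) (Icc a b ×ˢ Ico 0 T)
  cont_r : ContinuousOn (Function.uncurry r) (Icc a b ×ˢ Ico 0 T)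
  cont_dz : ContinuousOn (Function.uncurry (dl a b z)) (Icc a b ×ˢ Ico 0 T)
  cont_dr : ContinuousOn (Function.uncurry (dl a b r)) (Icc a b ×ˢ Ico 0 T)
  cont_ddz : ContinuousOn (Function.uncurry (dl a b (dl a b z))) (Icc a b ×ˢ Ico 0 T)
  cont_ddr : ContinuousOn (Function.uncurry (dl a b (dl a b r))) (Icc a b ×ˢ Ico 0 T)
  initial_z : ∀ l ∈ Icc a b, z l 0 = l
  initial_r : ∀ l ∈ Icc a b, r l 0 = ρ₀ l
  /-- The surface does not touch the axis of rotation before time `T`. -/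
  r_pos : ∀ l ∈ Icc a b, ∀ t ∈ Ico 0 T, 0 < r l t
  /-- Together with `left_z` and `right_z`: the surface at time `t` is generated by the graph of a
  radius function on `[a, b]`. -/
  dz_pos : ∀ l ∈ Icc a b, ∀ t ∈ Ico 0 T, 0 < dl a b z l t
  left_z : ∀ t ∈ Ico 0 T, z a t = a
  right_z : ∀ t ∈ Ico 0 T, z b t = b
  neumann_left : ∀ t ∈ Ico 0 T, dl a b r a t = 0
  neumann_right : ∀ t ∈ Ico 0 T, dl a b r b t = 0
  evolution : ∀ l ∈ Icc a b, ∀ w : Circle, ∀ t ∈ Ioo 0 T,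
    HasDerivAt (fun s => position z r l w s)
      (-(meanCurv a b z r l t - avgMeanCurv a b z r t) • unitNormal a b z r l w t) t

/-- The part of spacetime where the mean curvature exceeds `c₂ / 2`. -/
def hatRegion (a b T c₂ : ℝ) (z r : ℝ → ℝ → ℝ) : Set (Param a b × ℝ) :=
  {P | P.2 ∈ Ico 0 T ∧ c₂ / 2 < meanCurv a b z r P.1.1 P.2}

/-- The parabolic boundary of a subset `S` of `[a, b] × S¹ × [0, T)`: its topological boundary
in `[a, b] × S¹ × ℝ` without the slice at time `T`. (The points of the closure of `S` at time `0`
belong to it; the planes `x₁ = a` and `x₁ = b` do not contribute.) -/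
def parabolicBoundary {a b : ℝ} (T : ℝ) (S : Set (Param a b × ℝ)) : Set (Param a b × ℝ) :=
  frontier S \ {P | P.2 = T}

/-- The singularity at time `T` develops in `S`: the second fundamental form is unbounded on `S`
as `t → T`. -/
def SingularIn (a b T : ℝ) (z r : ℝ → ℝ → ℝ) (S : Set (Param a b × ℝ)) : Prop :=
  ∀ K : ℝ, ∀ t₀ < T, ∃ P ∈ S, t₀ < P.2 ∧ P.2 < T ∧ K < normASq a b z r P.1.1 P.2

end AxialFlow

end

/-! The blow-up rate comes from a lower bound `r² ≥ const · (T - t)` over `S`. There `|A|² ≤ c₁₂ H²`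
and `H > 0` give `H ≥ κ p` with `κ = 1 / √c₁₂`. A point of the closure of `S` before time `T` with
radius below `c₁₃` is interior to `S`, so a least radius over a slice, if it is that small, is a
spatial local minimum; there `p = 1 / r` and the radius moves with velocity `h - H ≤ h - κ / r`.
Apart from `h`, a radius `μ` would shrink to zero in a time of order `μ² / κ`; since `r > 0` before
`T`, the remaining time is at most of that order (`exists_r_le_barrier`, `exists_le_r_sq`).

The average `h` is controlled only in time average. Constancy of the volume and monotonicity of the
area give `h ≤ c (1 + η + D / η)` for every `η > 0` (`exists_avgMeanCurv_le`), where `D` is the rate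
of loss of area. The area has a limit at `T`, so the time integral of `D` is small near `T`. With
`η` proportional to `1 / μ`, the total effect of `h` over a time of order `μ²` is at most `μ`, which
the shrinking absorbs.

The radius controls `p ≤ 1 / r`. For `k`, the maximum principle for `k / p`, which uses `h ≥ 0`,
gives `k ≤ C p` (`exists_curvK_le_mul_curvP`), and `H > 0` gives `k > -p` on `S`. Hence `|A|² ≤ (C²
+ 1) / r²` on `S` at late times; earlier times are covered by compactness. -/

namespace AxialFlow

/-! ### Calculus of smooth functions on the strip. -/

/-- Derivative of `f (l, t)` in time. -/
noncomputable def dt (f : ℝ → ℝ → ℝ) (l t : ℝ) : ℝ := deriv (fun s => f l s) t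

/-- Smoothness on the strip `[a, b] × (0, T)`. -/
def SmoothStrip (a b T : ℝ) (f : ℝ → ℝ → ℝ) : Prop :=
  ContDiffOn ℝ ∞ (Function.uncurry f) (Icc a b ×ˢ Ioo 0 T)

lemma uniqueDiffOn_strip {a b : ℝ} (T : ℝ) (hab : a < b) :
    UniqueDiffOn ℝ (Icc a b ×ˢ Ioo (0 : ℝ) T) :=
  (uniqueDiffOn_Icc hab).prod isOpen_Ioo.uniqueDiffOn

/-- Symmetry of second derivatives within a set needs this at the lateral boundary of the strip. -/
lemma strip_subset_closure_interior {a b : ℝ} (T : ℝ) (hab : a < b) :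
    Icc a b ×ˢ Ioo (0 : ℝ) T ⊆ closure (interior (Icc a b ×ˢ Ioo (0 : ℝ) T)) := by
  rw [interior_prod_eq, closure_prod_eq, interior_Icc, isOpen_Ioo.interior_eq,
    closure_Ioo hab.ne]
  exact prod_mono le_rfl subset_closure

namespace SmoothStrip

variable {a b T : ℝ} {f g : ℝ → ℝ → ℝ} {l t : ℝ}

lemma hasDerivWithinAt_l_fderiv (hf : SmoothStrip a b T f) (hl : l ∈ Icc a b) (ht : t ∈ Ioo 0 T) :
    HasDerivWithinAt (fun s => f s t)
      (fderivWithin ℝ (Function.uncurry f) (Icc a b ×ˢ Ioo 0 T) (l, t) (1, 0)) (Icc a b) l := by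
  have h1 := (hf.differentiableOn (by simp) (l, t) ⟨hl, ht⟩).hasFDerivWithinAt
  have h2 : HasDerivWithinAt (fun s : ℝ => (s, t)) ((1 : ℝ), (0 : ℝ)) (Icc a b) l :=
    (hasDerivWithinAt_id l _).prodMk (hasDerivWithinAt_const l _ t)
  exact HasFDerivWithinAt.comp_hasDerivWithinAt (f := fun s : ℝ => (s, t)) l h1 h2
    (fun s hs => ⟨hs, ht⟩)

lemma hasDerivAt_t_fderiv (hf : SmoothStrip a b T f) (hl : l ∈ Icc a b) (ht : t ∈ Ioo 0 T) :
    HasDerivAt (fun s => f l s)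
      (fderivWithin ℝ (Function.uncurry f) (Icc a b ×ˢ Ioo 0 T) (l, t) (0, 1)) t := by
  have h1 := (hf.differentiableOn (by simp) (l, t) ⟨hl, ht⟩).hasFDerivWithinAt
  have h2 : HasDerivWithinAt (fun s : ℝ => (l, s)) ((0 : ℝ), (1 : ℝ)) (Ioo 0 T) t :=
    (hasDerivWithinAt_const t _ l).prodMk (hasDerivWithinAt_id t _)
  exact (HasFDerivWithinAt.comp_hasDerivWithinAt (f := fun s : ℝ => (l, s)) t h1 h2
    (fun s hs => ⟨hl, hs⟩)).hasDerivAt (Ioo_mem_nhds ht.1 ht.2)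

lemma dl_eq (hab : a < b) (hf : SmoothStrip a b T f) (hl : l ∈ Icc a b) (ht : t ∈ Ioo 0 T) :
    dl a b f l t =
      fderivWithin ℝ (Function.uncurry f) (Icc a b ×ˢ Ioo 0 T) (l, t) (1, 0) :=
  (hf.hasDerivWithinAt_l_fderiv hl ht).derivWithin (uniqueDiffOn_Icc hab l hl)

lemma dt_eq (hf : SmoothStrip a b T f) (hl : l ∈ Icc a b) (ht : t ∈ Ioo 0 T) :
    dt f l t = fderivWithin ℝ (Function.uncurry f) (Icc a b ×ˢ Ioo 0 T) (l, t) (0, 1) :=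
  (hf.hasDerivAt_t_fderiv hl ht).deriv

lemma hasDerivWithinAt_dl (hf : SmoothStrip a b T f) (hl : l ∈ Icc a b)
    (ht : t ∈ Ioo 0 T) : HasDerivWithinAt (fun s => f s t) (dl a b f l t) (Icc a b) l :=
  (hf.hasDerivWithinAt_l_fderiv hl ht).differentiableWithinAt.hasDerivWithinAt

lemma hasDerivAt_dt (hf : SmoothStrip a b T f) (hl : l ∈ Icc a b) (ht : t ∈ Ioo 0 T) :
    HasDerivAt (fun s => f l s) (dt f l t) t :=
  (hf.hasDerivAt_t_fderiv hl ht).differentiableAt.hasDerivAt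

lemma fderiv_smooth (hab : a < b) (hf : SmoothStrip a b T f) :
    ContDiffOn ℝ ∞ (fderivWithin ℝ (Function.uncurry f) (Icc a b ×ˢ Ioo 0 T))
      (Icc a b ×ˢ Ioo 0 T) :=
  ContDiffOn.fderivWithin hf (uniqueDiffOn_strip T hab) (by simp)

lemma dl (hab : a < b) (hf : SmoothStrip a b T f) : SmoothStrip a b T (dl a b f) :=
  ((hf.fderiv_smooth hab).clm_apply contDiffOn_const).congr
    (fun _ hP => hf.dl_eq hab hP.1 hP.2)

lemma dt (hab : a < b) (hf : SmoothStrip a b T f) : SmoothStrip a b T (dt f) :=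
  ((hf.fderiv_smooth hab).clm_apply contDiffOn_const).congr
    (fun _ hP => hf.dt_eq hP.1 hP.2)

lemma dl_dt (hab : a < b) (hf : SmoothStrip a b T f) (hl : l ∈ Icc a b) (ht : t ∈ Ioo 0 T) :
    AxialFlow.dt (AxialFlow.dl a b f) l t = AxialFlow.dl a b (AxialFlow.dt f) l t := by
  have hP : (l, t) ∈ Icc a b ×ˢ Ioo (0 : ℝ) T := ⟨hl, ht⟩
  have hu := uniqueDiffOn_strip T hab
  have htwo : minSmoothness ℝ 2 ≤ (∞ : WithTop ℕ∞) := by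
    rw [minSmoothness_of_isRCLikeNormedField]
    exact WithTop.coe_le_coe.2 (le_top : (2 : ℕ∞) ≤ ⊤)
  have hsymm : IsSymmSndFDerivWithinAt ℝ (Function.uncurry f) (Icc a b ×ˢ Ioo 0 T) (l, t) :=
    (hf (l, t) hP).isSymmSndFDerivWithinAt htwo hu (strip_subset_closure_interior T hab hP) hP
  have hd : DifferentiableWithinAt ℝ
      (fderivWithin ℝ (Function.uncurry f) (Icc a b ×ˢ Ioo 0 T)) (Icc a b ×ˢ Ioo 0 T) (l, t) :=
    ((hf.fderiv_smooth hab).differentiableOn (by simp)) (l, t) hP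
  have key : ∀ (g : ℝ → ℝ → ℝ) (u w : ℝ × ℝ),
      (∀ P ∈ Icc a b ×ˢ Ioo 0 T, Function.uncurry g P =
        fderivWithin ℝ (Function.uncurry f) (Icc a b ×ˢ Ioo 0 T) P u) →
      fderivWithin ℝ (Function.uncurry g) (Icc a b ×ˢ Ioo 0 T) (l, t) w =
        fderivWithin ℝ (fderivWithin ℝ (Function.uncurry f) (Icc a b ×ˢ Ioo 0 T))
          (Icc a b ×ˢ Ioo 0 T) (l, t) w u := by
    intro g u w hg
    rw [fderivWithin_congr hg (hg _ hP), fderivWithin_clm_apply (hu _ hP) hd (by fun_prop)]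
    simp
  rw [(hf.dl hab).dt_eq hl ht, (hf.dt hab).dl_eq hab hl ht,
    key (AxialFlow.dl a b f) (1, 0) _ (fun _ hP => hf.dl_eq hab hP.1 hP.2),
    key (AxialFlow.dt f) (0, 1) _ (fun _ hP => hf.dt_eq hP.1 hP.2)]
  exact hsymm _ _

lemma hasDerivAt_dl (hab : a < b) (hf : SmoothStrip a b T f) (hl : l ∈ Icc a b)
    (ht : t ∈ Ioo 0 T) :
    HasDerivAt (fun s => AxialFlow.dl a b f l s) (AxialFlow.dl a b (AxialFlow.dt f) l t) t :=
  hf.dl_dt hab hl ht ▸ (hf.dl hab).hasDerivAt_dt hl ht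

lemma continuousOn (hf : SmoothStrip a b T f) :
    ContinuousOn (Function.uncurry f) (Icc a b ×ˢ Ioo 0 T) := ContDiffOn.continuousOn hf

lemma slice_continuousOn (hf : SmoothStrip a b T f) (ht : t ∈ Ioo 0 T) :
    ContinuousOn (fun l => f l t) (Icc a b) :=
  fun _ hl => (hf.hasDerivWithinAt_dl hl ht).continuousWithinAt

lemma add (hf : SmoothStrip a b T f) (hg : SmoothStrip a b T g) :
    SmoothStrip a b T (fun l t => f l t + g l t) := ContDiffOn.add hf hg

lemma sub (hf : SmoothStrip a b T f) (hg : SmoothStrip a b T g) :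
    SmoothStrip a b T (fun l t => f l t - g l t) := ContDiffOn.sub hf hg

lemma mul (hf : SmoothStrip a b T f) (hg : SmoothStrip a b T g) :
    SmoothStrip a b T (fun l t => f l t * g l t) := ContDiffOn.mul hf hg

lemma pow (hf : SmoothStrip a b T f) (n : ℕ) :
    SmoothStrip a b T (fun l t => f l t ^ n) := ContDiffOn.pow hf n

lemma div (hf : SmoothStrip a b T f) (hg : SmoothStrip a b T g)
    (h0 : ∀ l ∈ Icc a b, ∀ t ∈ Ioo 0 T, g l t ≠ 0) :
    SmoothStrip a b T (fun l t => f l t / g l t) :=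
  ContDiffOn.div hf hg (fun _ hP => h0 _ hP.1 _ hP.2)

lemma sqrt (hf : SmoothStrip a b T f) (h0 : ∀ l ∈ Icc a b, ∀ t ∈ Ioo 0 T, f l t ≠ 0) :
    SmoothStrip a b T (fun l t => Real.sqrt (f l t)) :=
  ContDiffOn.sqrt hf (fun _ hP => h0 _ hP.1 _ hP.2)

end SmoothStrip

end AxialFlow

/-! ### The moving frame and the evolution of the curvatures. -/

namespace AxialFlow

/-- The cosine of the angle between the profile curve and the axis of rotation. -/
noncomputable def cosAngle (a b : ℝ) (z r : ℝ → ℝ → ℝ) (l t : ℝ) : ℝ :=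
  dl a b z l t / speed a b z r l t

/-- The sine of the angle between the profile curve and the axis of rotation. -/
noncomputable def sinAngle (a b : ℝ) (z r : ℝ → ℝ → ℝ) (l t : ℝ) : ℝ :=
  dl a b r l t / speed a b z r l t

namespace IsFlow

variable {a b T : ℝ} {ρ₀ : ℝ → ℝ} {z r : ℝ → ℝ → ℝ} {l t : ℝ}

lemma smoothStrip_z (F : IsFlow a b T ρ₀ z r) : SmoothStrip a b T z := F.smooth_z

lemma smoothStrip_r (F : IsFlow a b T ρ₀ z r) : SmoothStrip a b T r := F.smooth_r

lemma speedSq_pos (F : IsFlow a b T ρ₀ z r) (hl : l ∈ Icc a b) (ht : t ∈ Ico 0 T) :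
    0 < dl a b z l t ^ 2 + dl a b r l t ^ 2 := by
  have := F.dz_pos l hl t ht
  positivity

lemma speed_pos (F : IsFlow a b T ρ₀ z r) (hl : l ∈ Icc a b) (ht : t ∈ Ico 0 T) :
    0 < speed a b z r l t := Real.sqrt_pos.2 (F.speedSq_pos hl ht)

lemma speed_sq (z r : ℝ → ℝ → ℝ) :
    speed a b z r l t ^ 2 = dl a b z l t ^ 2 + dl a b r l t ^ 2 :=
  Real.sq_sqrt (by positivity)

lemma cosAngle_pos (F : IsFlow a b T ρ₀ z r) (hl : l ∈ Icc a b) (ht : t ∈ Ico 0 T) :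
    0 < cosAngle a b z r l t := div_pos (F.dz_pos l hl t ht) (F.speed_pos hl ht)

lemma dl_z (F : IsFlow a b T ρ₀ z r) (hl : l ∈ Icc a b) (ht : t ∈ Ico 0 T) :
    dl a b z l t = speed a b z r l t * cosAngle a b z r l t :=
  (mul_div_cancel₀ _ (F.speed_pos hl ht).ne').symm

lemma dl_r (F : IsFlow a b T ρ₀ z r) (hl : l ∈ Icc a b) (ht : t ∈ Ico 0 T) :
    dl a b r l t = speed a b z r l t * sinAngle a b z r l t :=
  (mul_div_cancel₀ _ (F.speed_pos hl ht).ne').symm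

lemma cos_sq_add_sin_sq (F : IsFlow a b T ρ₀ z r) (hl : l ∈ Icc a b) (ht : t ∈ Ico 0 T) :
    cosAngle a b z r l t ^ 2 + sinAngle a b z r l t ^ 2 = 1 := by
  have := F.speed_pos hl ht
  rw [cosAngle, sinAngle, div_pow, div_pow, ← add_div, ← speed_sq, div_self (by positivity)]

lemma curvP_eq (z r : ℝ → ℝ → ℝ) :
    curvP a b z r l t = cosAngle a b z r l t / r l t := rfl

lemma curvP_pos (F : IsFlow a b T ρ₀ z r) (hl : l ∈ Icc a b) (ht : t ∈ Ico 0 T) :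
    0 < curvP a b z r l t := div_pos (F.cosAngle_pos hl ht) (F.r_pos l hl t ht)

lemma curvP_le (F : IsFlow a b T ρ₀ z r) (hl : l ∈ Icc a b) (ht : t ∈ Ico 0 T) :
    curvP a b z r l t ≤ 1 / r l t := by
  have h1 := F.cos_sq_add_sin_sq hl ht
  have := F.r_pos l hl t ht
  rw [curvP_eq]
  gcongr
  nlinarith [sq_nonneg (sinAngle a b z r l t), sq_nonneg (cosAngle a b z r l t - 1)]

lemma smooth_speed (hab : a < b) (F : IsFlow a b T ρ₀ z r) :
    SmoothStrip a b T (speed a b z r) :=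
  ((F.smoothStrip_z.dl hab).pow 2 |>.add ((F.smoothStrip_r.dl hab).pow 2)).sqrt
    (fun _ hl _ ht => (F.speedSq_pos hl (Ioo_subset_Ico_self ht)).ne')

lemma smooth_cosAngle (hab : a < b) (F : IsFlow a b T ρ₀ z r) :
    SmoothStrip a b T (cosAngle a b z r) :=
  (F.smoothStrip_z.dl hab).div (F.smooth_speed hab)
    (fun _ hl _ ht => (F.speed_pos hl (Ioo_subset_Ico_self ht)).ne')

lemma smooth_sinAngle (hab : a < b) (F : IsFlow a b T ρ₀ z r) :
    SmoothStrip a b T (sinAngle a b z r) :=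
  (F.smoothStrip_r.dl hab).div (F.smooth_speed hab)
    (fun _ hl _ ht => (F.speed_pos hl (Ioo_subset_Ico_self ht)).ne')

lemma smooth_curvP (hab : a < b) (F : IsFlow a b T ρ₀ z r) :
    SmoothStrip a b T (curvP a b z r) :=
  (F.smooth_cosAngle hab).div F.smoothStrip_r
    (fun l hl t ht => (F.r_pos l hl t (Ioo_subset_Ico_self ht)).ne')

lemma smooth_curvK (hab : a < b) (F : IsFlow a b T ρ₀ z r) :
    SmoothStrip a b T (curvK a b z r) :=
  ((((F.smoothStrip_z.dl hab).dl hab).mul (F.smoothStrip_r.dl hab)).sub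
    ((F.smoothStrip_z.dl hab).mul ((F.smoothStrip_r.dl hab).dl hab))).div
    ((F.smooth_speed hab).pow 3)
    (fun _ hl _ ht => (pow_pos (F.speed_pos hl (Ioo_subset_Ico_self ht)) 3).ne')

lemma smooth_meanCurv (hab : a < b) (F : IsFlow a b T ρ₀ z r) :
    SmoothStrip a b T (meanCurv a b z r) := (F.smooth_curvK hab).add (F.smooth_curvP hab)

lemma hasDeriv_r (F : IsFlow a b T ρ₀ z r) (hl : l ∈ Icc a b) (ht : t ∈ Ioo 0 T) :
    HasDerivWithinAt (fun s => r s t) (speed a b z r l t * sinAngle a b z r l t) (Icc a b) l :=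
  F.dl_r hl (Ioo_subset_Ico_self ht) ▸ F.smoothStrip_r.hasDerivWithinAt_dl hl ht

lemma hasDeriv_speed (hab : a < b) (F : IsFlow a b T ρ₀ z r) (hl : l ∈ Icc a b)
    (ht : t ∈ Ioo 0 T) :
    HasDerivWithinAt (fun s => speed a b z r s t)
      ((dl a b z l t * dl a b (dl a b z) l t + dl a b r l t * dl a b (dl a b r) l t) /
        speed a b z r l t) (Icc a b) l := by
  have hv := F.speed_pos hl (Ioo_subset_Ico_self ht)
  have h1 := (F.smoothStrip_z.dl hab).hasDerivWithinAt_dl hl ht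
  have h2 := (F.smoothStrip_r.dl hab).hasDerivWithinAt_dl hl ht
  have h := ((h1.pow 2).add (h2.pow 2)).sqrt (F.speedSq_pos hl (Ioo_subset_Ico_self ht)).ne'
  refine h.congr_deriv ?_
  change _ / (2 * speed a b z r l t) = _
  field_simp
  ring

/-- Frenet equation: the tangent angle has arc length derivative `-k`. -/
lemma hasDeriv_cosAngle (hab : a < b) (F : IsFlow a b T ρ₀ z r) (hl : l ∈ Icc a b)
    (ht : t ∈ Ioo 0 T) :
    HasDerivWithinAt (fun s => cosAngle a b z r s t)
      (speed a b z r l t * curvK a b z r l t * sinAngle a b z r l t) (Icc a b) l := by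
  have hv := F.speed_pos hl (Ioo_subset_Ico_self ht)
  have h1 := (F.smoothStrip_z.dl hab).hasDerivWithinAt_dl hl ht
  refine (h1.div (F.hasDeriv_speed hab hl ht) hv.ne').congr_deriv ?_
  rw [sinAngle, curvK]
  field_simp
  rw [speed_sq]
  ring

lemma hasDeriv_sinAngle (hab : a < b) (F : IsFlow a b T ρ₀ z r) (hl : l ∈ Icc a b)
    (ht : t ∈ Ioo 0 T) :
    HasDerivWithinAt (fun s => sinAngle a b z r s t)
      (-(speed a b z r l t * curvK a b z r l t * cosAngle a b z r l t)) (Icc a b) l := by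
  have hv := F.speed_pos hl (Ioo_subset_Ico_self ht)
  have h1 := (F.smoothStrip_r.dl hab).hasDerivWithinAt_dl hl ht
  refine (h1.div (F.hasDeriv_speed hab hl ht) hv.ne').congr_deriv ?_
  rw [cosAngle, curvK]
  field_simp
  rw [speed_sq]
  ring

/-- Codazzi equation of a surface of revolution: `p_s = (r_s / r) (k - p)`. -/
lemma hasDeriv_curvP (hab : a < b) (F : IsFlow a b T ρ₀ z r) (hl : l ∈ Icc a b)
    (ht : t ∈ Ioo 0 T) :
    HasDerivWithinAt (fun s => curvP a b z r s t)
      (speed a b z r l t * (sinAngle a b z r l t / r l t) *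
        (curvK a b z r l t - curvP a b z r l t)) (Icc a b) l := by
  have hr := F.r_pos l hl t (Ioo_subset_Ico_self ht)
  refine ((F.hasDeriv_cosAngle hab hl ht).div (F.hasDeriv_r hl ht) hr.ne').congr_deriv ?_
  rw [curvP_eq]
  field_simp

/-- The speed of the flow in the direction of the unit normal. -/
noncomputable def normalSpeed (a b : ℝ) (z r : ℝ → ℝ → ℝ) (l t : ℝ) : ℝ :=
  avgMeanCurv a b z r t - meanCurv a b z r l t

lemma hasDeriv_normalSpeed (hab : a < b) (F : IsFlow a b T ρ₀ z r) (hl : l ∈ Icc a b)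
    (ht : t ∈ Ioo 0 T) :
    HasDerivWithinAt (fun s => normalSpeed a b z r s t) (-dl a b (meanCurv a b z r) l t)
      (Icc a b) l :=
  ((F.smooth_meanCurv hab).hasDerivWithinAt_dl hl ht).const_sub _

lemma evolution_z (F : IsFlow a b T ρ₀ z r) (hl : l ∈ Icc a b) (ht : t ∈ Ioo 0 T) :
    HasDerivAt (fun s => z l s) (-(normalSpeed a b z r l t * sinAngle a b z r l t)) t := by
  -- At the angle `1 : Circle` the position is `(z, r, 0)`, so single coordinates give the scalar
  -- equations.
  have h := ((EuclideanSpace.proj (0 : Fin 3) :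
    EuclideanSpace ℝ (Fin 3) →L[ℝ] ℝ).hasFDerivAt.comp_hasDerivAt t (F.evolution l hl 1 t ht))
  refine (h.congr_deriv ?_).congr_of_eventuallyEq (Filter.Eventually.of_forall fun s => ?_)
  · simp [unitNormal, normalSpeed, sinAngle]; left; ring
  · simp [position]

lemma evolution_r (F : IsFlow a b T ρ₀ z r) (hl : l ∈ Icc a b) (ht : t ∈ Ioo 0 T) :
    HasDerivAt (fun s => r l s) (normalSpeed a b z r l t * cosAngle a b z r l t) t := by
  have h := ((EuclideanSpace.proj (1 : Fin 3) :
    EuclideanSpace ℝ (Fin 3) →L[ℝ] ℝ).hasFDerivAt.comp_hasDerivAt t (F.evolution l hl 1 t ht))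
  refine (h.congr_deriv ?_).congr_of_eventuallyEq (Filter.Eventually.of_forall fun s => ?_)
  · simp [unitNormal, normalSpeed, cosAngle]; left; ring
  · simp [position]

lemma evolution_dl_z (hab : a < b) (F : IsFlow a b T ρ₀ z r) (hl : l ∈ Icc a b)
    (ht : t ∈ Ioo 0 T) :
    HasDerivAt (fun s => dl a b z l s) (dl a b (meanCurv a b z r) l t * sinAngle a b z r l t +
      normalSpeed a b z r l t * speed a b z r l t * curvK a b z r l t * cosAngle a b z r l t)
      t := by
  refine (F.smoothStrip_z.hasDerivAt_dl hab hl ht).congr_deriv ?_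
  refine HasDerivWithinAt.derivWithin ?_ (uniqueDiffOn_Icc hab l hl)
  refine (((F.hasDeriv_normalSpeed hab hl ht).mul (F.hasDeriv_sinAngle hab hl ht)).neg.congr_of_mem
    (fun s hs => (F.evolution_z hs ht).deriv) hl).congr_deriv ?_
  ring

lemma evolution_dl_r (hab : a < b) (F : IsFlow a b T ρ₀ z r) (hl : l ∈ Icc a b)
    (ht : t ∈ Ioo 0 T) :
    HasDerivAt (fun s => dl a b r l s) (-(dl a b (meanCurv a b z r) l t * cosAngle a b z r l t) +
      normalSpeed a b z r l t * speed a b z r l t * curvK a b z r l t * sinAngle a b z r l t)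
      t := by
  refine (F.smoothStrip_r.hasDerivAt_dl hab hl ht).congr_deriv ?_
  refine HasDerivWithinAt.derivWithin ?_ (uniqueDiffOn_Icc hab l hl)
  refine (((F.hasDeriv_normalSpeed hab hl ht).mul (F.hasDeriv_cosAngle hab hl ht)).congr_of_mem
    (fun s hs => (F.evolution_r hs ht).deriv) hl).congr_deriv ?_
  ring

lemma evolution_speed (hab : a < b) (F : IsFlow a b T ρ₀ z r) (hl : l ∈ Icc a b)
    (ht : t ∈ Ioo 0 T) :
    HasDerivAt (fun s => speed a b z r l s)
      (normalSpeed a b z r l t * curvK a b z r l t * speed a b z r l t) t := by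
  have ht' := Ioo_subset_Ico_self ht
  have hv := F.speed_pos hl ht'
  have h := (((F.evolution_dl_z hab hl ht).pow 2).add ((F.evolution_dl_r hab hl ht).pow 2)).sqrt
    (F.speedSq_pos hl ht').ne'
  refine h.congr_deriv ?_
  change _ / (2 * speed a b z r l t) = _
  rw [div_eq_iff (by positivity), F.dl_z hl ht', F.dl_r hl ht']
  linear_combination (2 * normalSpeed a b z r l t * curvK a b z r l t * speed a b z r l t ^ 2) *
    F.cos_sq_add_sin_sq hl ht'

/-- The tangent angle turns at the rate `-H_s`, the arc length derivative of the normal speed;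
stretching of the curve cancels. -/
lemma evolution_cosAngle (hab : a < b) (F : IsFlow a b T ρ₀ z r) (hl : l ∈ Icc a b)
    (ht : t ∈ Ioo 0 T) :
    HasDerivAt (fun s => cosAngle a b z r l s)
      (dl a b (meanCurv a b z r) l t / speed a b z r l t * sinAngle a b z r l t) t := by
  have ht' := Ioo_subset_Ico_self ht
  have hv := F.speed_pos hl ht'
  refine ((F.evolution_dl_z hab hl ht).div (F.evolution_speed hab hl ht) hv.ne').congr_deriv ?_
  rw [F.dl_z hl ht']
  field_simp
  ring

lemma evolution_sinAngle (hab : a < b) (F : IsFlow a b T ρ₀ z r) (hl : l ∈ Icc a b)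
    (ht : t ∈ Ioo 0 T) :
    HasDerivAt (fun s => sinAngle a b z r l s)
      (-(dl a b (meanCurv a b z r) l t / speed a b z r l t * cosAngle a b z r l t)) t := by
  have ht' := Ioo_subset_Ico_self ht
  have hv := F.speed_pos hl ht'
  refine ((F.evolution_dl_r hab hl ht).div (F.evolution_speed hab hl ht) hv.ne').congr_deriv ?_
  rw [F.dl_r hl ht']
  field_simp
  ring

lemma evolution_curvP (hab : a < b) (F : IsFlow a b T ρ₀ z r) (hl : l ∈ Icc a b)
    (ht : t ∈ Ioo 0 T) :
    HasDerivAt (fun s => curvP a b z r l s)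
      (dl a b (meanCurv a b z r) l t / speed a b z r l t * (sinAngle a b z r l t / r l t) -
        normalSpeed a b z r l t * curvP a b z r l t ^ 2) t := by
  have hr := F.r_pos l hl t (Ioo_subset_Ico_self ht)
  refine ((F.evolution_cosAngle hab hl ht).div (F.evolution_r hl ht) hr.ne').congr_deriv ?_
  rw [curvP_eq]
  field_simp

/-- The derivative with respect to the arc length of the profile curve. -/
noncomputable def ds (a b : ℝ) (z r f : ℝ → ℝ → ℝ) (l t : ℝ) : ℝ :=
  dl a b f l t / speed a b z r l t

lemma smooth_ds (hab : a < b) (F : IsFlow a b T ρ₀ z r) {f : ℝ → ℝ → ℝ}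
    (hf : SmoothStrip a b T f) : SmoothStrip a b T (ds a b z r f) :=
  (hf.dl hab).div (F.smooth_speed hab)
    (fun _ hl _ ht => (F.speed_pos hl (Ioo_subset_Ico_self ht)).ne')

/-- Since `k` is minus the arc length derivative of the tangent angle, its time derivative is `H_ss`
from the turning of the frame and `-(h - H) k²` from the change of arc length. -/
lemma evolution_curvK (hab : a < b) (F : IsFlow a b T ρ₀ z r) (hl : l ∈ Icc a b)
    (ht : t ∈ Ioo 0 T) :
    HasDerivAt (fun s => curvK a b z r l s)
      (ds a b z r (ds a b z r (meanCurv a b z r)) l t -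
        normalSpeed a b z r l t * curvK a b z r l t ^ 2) t := by
  have ht' := Ioo_subset_Ico_self ht
  have hv := F.speed_pos hl ht'
  have hu := uniqueDiffOn_Icc hab l hl
  have hg := (F.smooth_ds hab (F.smooth_meanCurv hab)).hasDerivWithinAt_dl hl ht
  have hc := (F.smooth_cosAngle hab).hasDerivAt_dl hab hl ht
  have hs := (F.smooth_sinAngle hab).hasDerivAt_dl hab hl ht
  have hc' : dl a b (dt (cosAngle a b z r)) l t = _ :=
    ((hg.mul (F.hasDeriv_sinAngle hab hl ht)).congr_of_mem
      (fun s hs => (F.evolution_cosAngle hab hs ht).deriv) hl).derivWithin hu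
  have hs' : dl a b (dt (sinAngle a b z r)) l t = _ :=
    ((hg.mul (F.hasDeriv_cosAngle hab hl ht)).neg.congr_of_mem
      (fun s hs => (F.evolution_sinAngle hab hs ht).deriv) hl).derivWithin hu
  rw [hc'] at hc
  rw [hs'] at hs
  -- In terms of the frame, only the commutation of one space and one time derivative of the sine
  -- and cosine is needed.
  have hk : (fun s => curvK a b z r l s) =ᶠ[nhds t] fun s =>
      (dl a b (cosAngle a b z r) l s * sinAngle a b z r l s -
        dl a b (sinAngle a b z r) l s * cosAngle a b z r l s) / speed a b z r l s := by
    filter_upwards [Ioo_mem_nhds ht.1 ht.2] with s hs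
    have hs' := Ioo_subset_Ico_self hs
    have hvs := F.speed_pos hl hs'
    have e1 : dl a b (cosAngle a b z r) l s = _ := (F.hasDeriv_cosAngle hab hl hs).derivWithin hu
    have e2 : dl a b (sinAngle a b z r) l s = _ := (F.hasDeriv_sinAngle hab hl hs).derivWithin hu
    rw [e1, e2, eq_div_iff hvs.ne']
    linear_combination (-curvK a b z r l s * speed a b z r l s) * F.cos_sq_add_sin_sq hl hs'
  have h := (((hc.mul (F.evolution_sinAngle hab hl ht)).sub
    (hs.mul (F.evolution_cosAngle hab hl ht))).div (F.evolution_speed hab hl ht)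
      hv.ne').congr_of_eventuallyEq hk
  refine h.congr_deriv ?_
  have e1 : dl a b (cosAngle a b z r) l t = _ := (F.hasDeriv_cosAngle hab hl ht).derivWithin hu
  have e2 : dl a b (sinAngle a b z r) l t = _ := (F.hasDeriv_sinAngle hab hl ht).derivWithin hu
  have e3 : dl a b (ds a b z r (meanCurv a b z r)) l t =
    speed a b z r l t * ds a b z r (ds a b z r (meanCurv a b z r)) l t :=
    (mul_div_cancel₀ _ hv.ne').symm
  have e4 : dl a b (meanCurv a b z r) l t =
    speed a b z r l t * ds a b z r (meanCurv a b z r) l t :=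
    (mul_div_cancel₀ _ hv.ne').symm
  simp only [Pi.mul_apply, Pi.sub_apply]
  rw [e1, e2, e3, e4, div_eq_iff (by positivity)]
  linear_combination (speed a b z r l t ^ 2 * (ds a b z r (ds a b z r (meanCurv a b z r)) l t -
    normalSpeed a b z r l t * curvK a b z r l t ^ 2)) * F.cos_sq_add_sin_sq hl ht'

end IsFlow
end AxialFlow

/-! ### Area, volume and the average of the mean curvature. -/

namespace AxialFlow

open MeasureTheory intervalIntegral Filter Topology

lemma integral_eq_sub_of_hasDerivWithinAt_Icc {a b : ℝ} (hab : a ≤ b) {f f' : ℝ → ℝ}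
    (hd : ∀ l ∈ Icc a b, HasDerivWithinAt f (f' l) (Icc a b) l)
    (hc : ContinuousOn f' (Icc a b)) : ∫ l in a..b, f' l = f b - f a :=
  integral_eq_sub_of_hasDerivAt_of_le hab (fun l hl => (hd l hl).continuousWithinAt)
    (fun l hl => (hd l (Ioo_subset_Icc_self hl)).hasDerivAt (Icc_mem_nhds hl.1 hl.2))
    (hc.intervalIntegrable_of_Icc hab)

namespace SmoothStrip

variable {a b T : ℝ} {f : ℝ → ℝ → ℝ} {t : ℝ}

lemma intervalIntegrable (hab : a < b) (hf : SmoothStrip a b T f) (ht : t ∈ Ioo 0 T) :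
    IntervalIntegrable (fun l => f l t) volume a b :=
  (hf.slice_continuousOn ht).intervalIntegrable_of_Icc hab.le

lemma hasDerivAt_integral (hab : a < b) (hf : SmoothStrip a b T f) (ht : t ∈ Ioo 0 T) :
    HasDerivAt (fun s => ∫ l in a..b, f l s) (∫ l in a..b, AxialFlow.dt f l t) t := by
  obtain ⟨t₁, h1, h1'⟩ := exists_between ht.1
  obtain ⟨t₂, h2, h2'⟩ := exists_between ht.2
  have hsub : Icc t₁ t₂ ⊆ Ioo 0 T := fun s hs => ⟨h1.trans_le hs.1, hs.2.trans_lt h2'⟩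
  obtain ⟨K, hK⟩ := (isCompact_Icc.prod isCompact_Icc).exists_bound_of_continuousOn
    ((hf.dt hab).continuousOn.mono (prod_mono (le_refl (Icc a b)) hsub))
  have hU : Set.uIoc a b ⊆ Icc a b := by
    rw [uIoc_of_le hab.le]; exact Ioc_subset_Icc_self
  have hnhds : Icc t₁ t₂ ∈ 𝓝 t := Icc_mem_nhds h1' h2
  refine (intervalIntegral.hasDerivAt_integral_of_dominated_loc_of_deriv_le
    (F := fun s l => f l s) (F' := fun s l => AxialFlow.dt f l s) (bound := fun _ => K)
    hnhds ?_ (hf.intervalIntegrable hab ht) ?_ ?_ intervalIntegrable_const ?_).2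
  · filter_upwards [hnhds] with s hs
    exact (intervalIntegrable_iff.1 (hf.intervalIntegrable hab (hsub hs))).aestronglyMeasurable
  · exact (intervalIntegrable_iff.1 ((hf.dt hab).intervalIntegrable hab ht)).aestronglyMeasurable
  · exact Eventually.of_forall fun l hl s hs => hK (l, s) ⟨hU hl, hs⟩
  · exact Eventually.of_forall fun l hl s hs => hf.hasDerivAt_dt (hU hl) (hsub hs)

end SmoothStrip

/-- The area of the surface divided by `2π`. -/
noncomputable def area (a b : ℝ) (z r : ℝ → ℝ → ℝ) (t : ℝ) : ℝ :=
  ∫ l in a..b, r l t * speed a b z r l t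

/-- The enclosed volume divided by `π`. -/
noncomputable def enclosedVolume (a b : ℝ) (z r : ℝ → ℝ → ℝ) (t : ℝ) : ℝ :=
  ∫ l in a..b, r l t ^ 2 * dl a b z l t

namespace IsFlow

variable {a b T : ℝ} {ρ₀ : ℝ → ℝ} {z r : ℝ → ℝ → ℝ} {l t : ℝ}

/-- The rate at which the flow decreases the area, divided by `2π`. -/
noncomputable def dissipation (a b : ℝ) (z r : ℝ → ℝ → ℝ) (t : ℝ) : ℝ :=
  ∫ l in a..b, normalSpeed a b z r l t ^ 2 * (r l t * speed a b z r l t)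

lemma smooth_areaElement (hab : a < b) (F : IsFlow a b T ρ₀ z r) :
    SmoothStrip a b T (fun l t => r l t * speed a b z r l t) :=
  F.smoothStrip_r.mul (F.smooth_speed hab)

lemma areaElement_pos (F : IsFlow a b T ρ₀ z r) (hl : l ∈ Icc a b) (ht : t ∈ Ico 0 T) :
    0 < r l t * speed a b z r l t := mul_pos (F.r_pos l hl t ht) (F.speed_pos hl ht)

lemma area_pos (hab : a < b) (F : IsFlow a b T ρ₀ z r) (ht : t ∈ Ioo 0 T) :
    0 < area a b z r t :=
  intervalIntegral_pos_of_pos_on ((F.smooth_areaElement hab).intervalIntegrable hab ht)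
    (fun _ hl => F.areaElement_pos (Ioo_subset_Icc_self hl) (Ioo_subset_Ico_self ht)) hab

lemma enclosedVolume_pos (hab : a < b) (F : IsFlow a b T ρ₀ z r) (ht : t ∈ Ioo 0 T) :
    0 < enclosedVolume a b z r t :=
  intervalIntegral_pos_of_pos_on
    (((F.smoothStrip_r.pow 2).mul (F.smoothStrip_z.dl hab)).intervalIntegrable hab ht)
    (fun l hl => mul_pos (pow_pos (F.r_pos l (Ioo_subset_Icc_self hl) t (Ioo_subset_Ico_self ht)) 2)
      (F.dz_pos l (Ioo_subset_Icc_self hl) t (Ioo_subset_Ico_self ht))) hab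

lemma avgMeanCurv_mul_area (hab : a < b) (F : IsFlow a b T ρ₀ z r) (ht : t ∈ Ioo 0 T) :
    avgMeanCurv a b z r t * area a b z r t =
      ∫ l in a..b, meanCurv a b z r l t * (r l t * speed a b z r l t) := by
  have h1 : ∫ l in a..b, areaDensity a b z r l t = 2 * Real.pi * area a b z r t := by
    rw [area, ← intervalIntegral.integral_const_mul]
    congr 1; funext l; rw [areaDensity]; ring
  have h2 : ∫ l in a..b, meanCurv a b z r l t * areaDensity a b z r l t = 2 * Real.pi *
      ∫ l in a..b, meanCurv a b z r l t * (r l t * speed a b z r l t) := by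
    rw [← intervalIntegral.integral_const_mul]
    congr 1; funext l; rw [areaDensity]; ring
  have hA := F.area_pos hab ht
  rw [avgMeanCurv, h1, h2]
  field_simp

lemma continuousOn_normalSpeed (hab : a < b) (F : IsFlow a b T ρ₀ z r) (ht : t ∈ Ioo 0 T) :
    ContinuousOn (fun l => normalSpeed a b z r l t) (Icc a b) :=
  fun _ hl => (F.hasDeriv_normalSpeed hab hl ht).continuousWithinAt

lemma integral_normalSpeed (hab : a < b) (F : IsFlow a b T ρ₀ z r) (ht : t ∈ Ioo 0 T) :
    ∫ l in a..b, normalSpeed a b z r l t * (r l t * speed a b z r l t) = 0 := by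
  have h := F.avgMeanCurv_mul_area hab ht
  rw [area, ← intervalIntegral.integral_const_mul] at h
  rw [← sub_eq_zero, ← intervalIntegral.integral_sub] at h
  · rw [← h]
    congr 1; funext l; rw [normalSpeed]; ring
  · exact ((F.smooth_areaElement hab).intervalIntegrable hab ht).const_mul _
  · exact ((F.smooth_meanCurv hab).mul (F.smooth_areaElement hab)).intervalIntegrable hab ht

lemma sinAngle_eq_zero (F : IsFlow a b T ρ₀ z r) (hl : l = a ∨ l = b) (ht : t ∈ Ico 0 T) :
    sinAngle a b z r l t = 0 := by
  rcases hl with rfl | rfl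
  · rw [sinAngle, F.neumann_left t ht, zero_div]
  · rw [sinAngle, F.neumann_right t ht, zero_div]

/-- Integrate `k` by parts with the tangent angle `θ`, for which `θ' = -k |∂𝐱/∂l|`. The Neumann
condition removes the boundary terms, and the integrand becomes `cos θ + θ sin θ` times the speed,
where `θ` and `sin θ` have the same sign. -/
lemma avgMeanCurv_nonneg (hab : a < b) (F : IsFlow a b T ρ₀ z r) (ht : t ∈ Ioo 0 T) :
    0 ≤ avgMeanCurv a b z r t := by
  have ht' := Ioo_subset_Ico_self ht
  have hA := F.area_pos hab ht
  suffices h : 0 ≤ avgMeanCurv a b z r t * area a b z r t from nonneg_of_mul_nonneg_left h hA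
  rw [F.avgMeanCurv_mul_area hab ht]
  set θ : ℝ → ℝ := fun l => Real.arctan (sinAngle a b z r l t / cosAngle a b z r l t) with hθ
  have hθd : ∀ l ∈ Icc a b, HasDerivWithinAt θ
      (-(speed a b z r l t * curvK a b z r l t)) (Icc a b) l := by
    intro l hl
    have hc := F.cosAngle_pos hl ht'
    have h1 := F.cos_sq_add_sin_sq hl ht'
    refine (((F.hasDeriv_sinAngle hab hl ht).div (F.hasDeriv_cosAngle hab hl ht)
      hc.ne').arctan).congr_deriv ?_
    have h2 : 1 + (sinAngle a b z r l t / cosAngle a b z r l t) ^ 2 =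
        1 / cosAngle a b z r l t ^ 2 := by
      have : 1 + (sinAngle a b z r l t / cosAngle a b z r l t) ^ 2 =
          (cosAngle a b z r l t ^ 2 + sinAngle a b z r l t ^ 2) / cosAngle a b z r l t ^ 2 := by
        field_simp
      rw [this, h1]
    rw [Pi.div_apply, h2]
    field_simp
    linear_combination (-speed a b z r l t * curvK a b z r l t) * h1
  have hθc : ContinuousOn θ (Icc a b) := fun l hl => (hθd l hl).continuousWithinAt
  have hvk := (F.smooth_speed hab).mul (F.smooth_curvK hab)
  have hvs := (F.smooth_speed hab).mul (F.smooth_sinAngle hab)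
  have hfc : ContinuousOn (fun l => speed a b z r l t * sinAngle a b z r l t * θ l -
      r l t * (speed a b z r l t * curvK a b z r l t)) (Icc a b) :=
    ((hvs.slice_continuousOn ht).mul hθc).sub ((F.smoothStrip_r.mul hvk).slice_continuousOn ht)
  have hftc := integral_eq_sub_of_hasDerivWithinAt_Icc hab.le
    (f := fun l => r l t * θ l) (f' := fun l => speed a b z r l t * sinAngle a b z r l t * θ l -
      r l t * (speed a b z r l t * curvK a b z r l t))
    (fun l hl => ((F.hasDeriv_r hl ht).mul (hθd l hl)).congr_deriv (by ring)) hfc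
  have h0 : ∀ l, l = a ∨ l = b → θ l = 0 := fun l hl => by
    simp [hθ, F.sinAngle_eq_zero hl ht']
  rw [h0 a (Or.inl rfl), h0 b (Or.inr rfl), mul_zero, mul_zero, sub_zero] at hftc
  have hadd := integral_add
    (((F.smooth_meanCurv hab).mul (F.smooth_areaElement hab)).intervalIntegrable hab ht)
    (hfc.intervalIntegrable_of_Icc (μ := volume) hab.le)
  rw [hftc, add_zero] at hadd
  rw [← hadd]
  refine intervalIntegral.integral_nonneg hab.le fun l hl => ?_
  have hc := F.cosAngle_pos hl ht'
  have hv := F.speed_pos hl ht'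
  have hr := F.r_pos l hl t ht'
  have hθs : 0 ≤ sinAngle a b z r l t * θ l := by
    rcases le_total 0 (sinAngle a b z r l t) with h | h
    · exact mul_nonneg h (Real.arctan_nonneg.2 (div_nonneg h hc.le))
    · refine mul_nonneg_of_nonpos_of_nonpos h ?_
      rw [← Real.arctan_zero]
      exact Real.arctan_strictMono.monotone (div_nonpos_of_nonpos_of_nonneg h hc.le)
  have e : meanCurv a b z r l t * (r l t * speed a b z r l t) +
      (speed a b z r l t * sinAngle a b z r l t * θ l -
      r l t * (speed a b z r l t * curvK a b z r l t)) =
      speed a b z r l t * (cosAngle a b z r l t + sinAngle a b z r l t * θ l) := by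
    rw [meanCurv, curvP_eq]; field_simp; ring
  rw [e]
  positivity

lemma dt_areaElement (hab : a < b) (F : IsFlow a b T ρ₀ z r) (hl : l ∈ Icc a b)
    (ht : t ∈ Ioo 0 T) :
    dt (fun l t => r l t * speed a b z r l t) l t =
      normalSpeed a b z r l t * avgMeanCurv a b z r t * (r l t * speed a b z r l t) -
      normalSpeed a b z r l t ^ 2 * (r l t * speed a b z r l t) := by
  have hr := F.r_pos l hl t (Ioo_subset_Ico_self ht)
  refine ((F.evolution_r hl ht).mul (F.evolution_speed hab hl ht)).deriv.trans ?_
  have : cosAngle a b z r l t = r l t * curvP a b z r l t := by rw [curvP_eq]; field_simp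
  rw [this, normalSpeed, meanCurv]
  ring

/-- First variation: the rate is the integral of `f H` with `f = h - H`, and `H = h - f` where `f`
has mean zero. -/
lemma hasDerivAt_area (hab : a < b) (F : IsFlow a b T ρ₀ z r) (ht : t ∈ Ioo 0 T) :
    HasDerivAt (area a b z r) (-dissipation a b z r t) t := by
  refine ((F.smooth_areaElement hab).hasDerivAt_integral hab ht).congr_deriv ?_
  have hc := F.continuousOn_normalSpeed hab ht
  have hA := (F.smooth_areaElement hab).slice_continuousOn ht
  calc ∫ l in a..b, dt (fun l t => r l t * speed a b z r l t) l t
      = ∫ l in a..b, (avgMeanCurv a b z r t *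
          (normalSpeed a b z r l t * (r l t * speed a b z r l t)) -
          normalSpeed a b z r l t ^ 2 * (r l t * speed a b z r l t)) := by
        refine integral_congr fun l hl => ?_
        rw [uIcc_of_le hab.le] at hl
        simp only [F.dt_areaElement hab hl ht]
        ring
    _ = -dissipation a b z r t := by
        rw [intervalIntegral.integral_sub, intervalIntegral.integral_const_mul,
          F.integral_normalSpeed hab ht, dissipation]
        · ring
        · exact ((continuousOn_const.mul (hc.mul hA))).intervalIntegrable_of_Icc hab.le
        · exact ((hc.pow 2).mul hA).intervalIntegrable_of_Icc hab.le

lemma dissipation_nonneg (hab : a < b) (F : IsFlow a b T ρ₀ z r) (ht : t ∈ Ioo 0 T) :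
    0 ≤ dissipation a b z r t :=
  intervalIntegral.integral_nonneg hab.le fun _ hl =>
    mul_nonneg (sq_nonneg _) (F.areaElement_pos hl (Ioo_subset_Ico_self ht)).le

lemma area_antitoneOn (hab : a < b) (F : IsFlow a b T ρ₀ z r) :
    AntitoneOn (area a b z r) (Ioo 0 T) := by
  refine antitoneOn_of_deriv_nonpos (convex_Ioo 0 T)
    (fun t ht => (F.hasDerivAt_area hab ht).continuousAt.continuousWithinAt) ?_ ?_
  · rw [interior_Ioo]
    exact fun t ht => (F.hasDerivAt_area hab ht).differentiableAt.differentiableWithinAt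
  · rw [interior_Ioo]
    intro t ht
    rw [(F.hasDerivAt_area hab ht).deriv]
    exact neg_nonpos.2 (F.dissipation_nonneg hab ht)

lemma dt_volumeElement (hab : a < b) (F : IsFlow a b T ρ₀ z r) (hl : l ∈ Icc a b)
    (ht : t ∈ Ioo 0 T) :
    dt (fun l t => r l t ^ 2 * dl a b z l t) l t =
      2 * (normalSpeed a b z r l t * (r l t * speed a b z r l t)) +
      (r l t ^ 2 * (dl a b (meanCurv a b z r) l t * sinAngle a b z r l t +
        normalSpeed a b z r l t * (speed a b z r l t * curvK a b z r l t * cosAngle a b z r l t)) -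
        2 * r l t * (speed a b z r l t * sinAngle a b z r l t) *
          (normalSpeed a b z r l t * sinAngle a b z r l t)) := by
  refine (((F.evolution_r hl ht).pow 2).mul (F.evolution_dl_z hab hl ht)).deriv.trans ?_
  rw [F.dl_z hl (Ioo_subset_Ico_self ht)]
  simp only [Pi.pow_apply]
  push_cast
  linear_combination (2 * r l t * normalSpeed a b z r l t * speed a b z r l t) *
    F.cos_sq_add_sin_sq hl (Ioo_subset_Ico_self ht)

/-- The volume element changes by `2 f` times the area element, whose integral is zero, plus the
`l`-derivative of `-r² f sin θ`, which vanishes at both ends by orthogonality (`f = h - H`). -/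
lemma hasDerivAt_enclosedVolume (hab : a < b) (F : IsFlow a b T ρ₀ z r) (ht : t ∈ Ioo 0 T) :
    HasDerivAt (enclosedVolume a b z r) 0 t := by
  have ht' := Ioo_subset_Ico_self ht
  refine (((F.smoothStrip_r.pow 2).mul (F.smoothStrip_z.dl hab)).hasDerivAt_integral
    hab ht).congr_deriv ?_
  have hc := F.continuousOn_normalSpeed hab ht
  have hA := (F.smooth_areaElement hab).slice_continuousOn ht
  have hr := F.smoothStrip_r.slice_continuousOn ht
  have hs := (F.smooth_sinAngle hab).slice_continuousOn ht
  have hvs := ((F.smooth_speed hab).mul (F.smooth_sinAngle hab)).slice_continuousOn ht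
  have hvk := (((F.smooth_speed hab).mul (F.smooth_curvK hab)).mul
    (F.smooth_cosAngle hab)).slice_continuousOn ht
  have hH := ((F.smooth_meanCurv hab).dl hab).slice_continuousOn ht
  have hcont : ContinuousOn (fun l =>
      (r l t ^ 2 * (dl a b (meanCurv a b z r) l t * sinAngle a b z r l t +
        normalSpeed a b z r l t * (speed a b z r l t * curvK a b z r l t * cosAngle a b z r l t)) -
        2 * r l t * (speed a b z r l t * sinAngle a b z r l t) *
          (normalSpeed a b z r l t * sinAngle a b z r l t))) (Icc a b) :=
    ((hr.pow 2).mul ((hH.mul hs).add (hc.mul hvk))).sub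
      (((continuousOn_const.mul hr).mul hvs).mul (hc.mul hs))
  have hftc := integral_eq_sub_of_hasDerivWithinAt_Icc hab.le
    (f := fun l => -(r l t ^ 2 * (normalSpeed a b z r l t * sinAngle a b z r l t)))
    (fun l hl => (((F.hasDeriv_r hl ht).pow 2).mul ((F.hasDeriv_normalSpeed hab hl ht).mul
      (F.hasDeriv_sinAngle hab hl ht))).neg.congr_deriv
        (by simp only [Pi.mul_apply, Pi.pow_apply]; push_cast; ring)) hcont
  rw [F.sinAngle_eq_zero (Or.inl rfl) ht', F.sinAngle_eq_zero (Or.inr rfl) ht'] at hftc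
  calc ∫ l in a..b, dt (fun l t => r l t ^ 2 * dl a b z l t) l t
      = ∫ l in a..b, (2 * (normalSpeed a b z r l t * (r l t * speed a b z r l t)) + _) := by
        refine integral_congr fun l hl => ?_
        rw [uIcc_of_le hab.le] at hl
        exact F.dt_volumeElement hab hl ht
    _ = 0 := by
        have hi : ContinuousOn (fun l => 2 * (normalSpeed a b z r l t *
            (r l t * speed a b z r l t))) (Icc a b) := continuousOn_const.mul (hc.mul hA)
        rw [intervalIntegral.integral_add (hi.intervalIntegrable_of_Icc hab.le)
          (hcont.intervalIntegrable_of_Icc hab.le), hftc, intervalIntegral.integral_const_mul,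
          F.integral_normalSpeed hab ht]
        ring

lemma enclosedVolume_const (hab : a < b) (F : IsFlow a b T ρ₀ z r) {s : ℝ} (hs : s ∈ Ioo 0 T)
    (ht : t ∈ Ioo 0 T) : enclosedVolume a b z r s = enclosedVolume a b z r t :=
  isOpen_Ioo.is_const_of_deriv_eq_zero isPreconnected_Ioo
    (fun _ h => (F.hasDerivAt_enclosedVolume hab h).differentiableAt.differentiableWithinAt)
    (fun _ h => (F.hasDerivAt_enclosedVolume hab h).deriv) hs ht

lemma sinAngle_abs_le (F : IsFlow a b T ρ₀ z r) (hl : l ∈ Icc a b) (ht : t ∈ Ico 0 T) :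
    |sinAngle a b z r l t| ≤ 1 := by
  rw [← sq_le_one_iff_abs_le_one, ← F.cos_sq_add_sin_sq hl ht]
  nlinarith [sq_nonneg (cosAngle a b z r l t)]

lemma cosAngle_le (F : IsFlow a b T ρ₀ z r) (hl : l ∈ Icc a b) (ht : t ∈ Ico 0 T) :
    cosAngle a b z r l t ≤ 1 := by
  have := F.cos_sq_add_sin_sq hl ht
  nlinarith [sq_nonneg (sinAngle a b z r l t), sq_nonneg (cosAngle a b z r l t - 1)]

/-- The derivative of `r²` is the area element times `2 sin θ`. -/
lemma abs_r_sq_sub_le (hab : a < b) (F : IsFlow a b T ρ₀ z r) (ht : t ∈ Ioo 0 T) {u w : ℝ}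
    (hu : a ≤ u) (huw : u ≤ w) (hw : w ≤ b) :
    |r w t ^ 2 - r u t ^ 2| ≤ 2 * area a b z r t := by
  have ht' := Ioo_subset_Ico_self ht
  have hsub : Icc u w ⊆ Icc a b := Icc_subset_Icc hu hw
  have hA := (F.smooth_areaElement hab).slice_continuousOn ht
  have hs := (F.smooth_sinAngle hab).slice_continuousOn ht
  have h2A : ContinuousOn (fun l => 2 * (r l t * speed a b z r l t)) (Icc a b) :=
    continuousOn_const.mul hA
  rw [← integral_eq_sub_of_hasDerivWithinAt_Icc huw (f := fun l => r l t ^ 2)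
    (f' := fun l => 2 * (r l t * speed a b z r l t) * sinAngle a b z r l t)
    (fun l hl => (((F.hasDeriv_r (hsub hl) ht).mono hsub).pow 2).congr_deriv
      (by push_cast; ring)) ((h2A.mul hs).mono hsub)]
  calc |∫ l in u..w, 2 * (r l t * speed a b z r l t) * sinAngle a b z r l t|
      ≤ ∫ l in u..w, |2 * (r l t * speed a b z r l t) * sinAngle a b z r l t| :=
        abs_integral_le_integral_abs huw
    _ ≤ ∫ l in u..w, 2 * (r l t * speed a b z r l t) := by
        refine integral_mono_on huw (((h2A.mul hs).abs.mono hsub).intervalIntegrable_of_Icc huw)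
          ((h2A.mono hsub).intervalIntegrable_of_Icc huw) fun l hl => ?_
        have hp := F.areaElement_pos (hsub hl) ht'
        rw [abs_mul, abs_of_pos (by positivity : 0 < 2 * (r l t * speed a b z r l t))]
        exact mul_le_of_le_one_right (by positivity) (F.sinAngle_abs_le (hsub hl) ht')
    _ ≤ ∫ l in a..b, 2 * (r l t * speed a b z r l t) := by
        refine integral_mono_interval hu huw hw ?_ (h2A.intervalIntegrable_of_Icc hab.le)
        refine (ae_restrict_iff' measurableSet_Ioc).2 (Eventually.of_forall fun l hl => ?_)
        have hp := F.areaElement_pos (Ioc_subset_Icc_self hl) ht'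
        simp only [Pi.zero_apply]
        positivity
    _ = 2 * area a b z r t := intervalIntegral.integral_const_mul _ _

/-- The oscillation of `r²` is bounded by the area, and its average over the axial length `b - a` by
the volume. -/
lemma r_sq_le (hab : a < b) (F : IsFlow a b T ρ₀ z r) (hl : l ∈ Icc a b) (ht : t ∈ Ioo 0 T) :
    r l t ^ 2 ≤ enclosedVolume a b z r t / (b - a) + 2 * area a b z r t := by
  have ht' := Ioo_subset_Ico_self ht
  have hle : ∀ x ∈ Icc a b, r l t ^ 2 - 2 * area a b z r t ≤ r x t ^ 2 := by
    intro x hx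
    rcases le_total x l with h | h
    · linarith [(abs_le.1 (F.abs_r_sq_sub_le hab ht hx.1 h hl.2)).2]
    · linarith [(abs_le.1 (F.abs_r_sq_sub_le hab ht hl.1 h hx.2)).1]
  have hz := (F.smoothStrip_z.dl hab).slice_continuousOn ht
  have hr := F.smoothStrip_r.slice_continuousOn ht
  have hftc := integral_eq_sub_of_hasDerivWithinAt_Icc hab.le
    (fun x hx => F.smoothStrip_z.hasDerivWithinAt_dl hx ht) hz
  rw [F.left_z t ht', F.right_z t ht'] at hftc
  have h : ∫ x in a..b, (r l t ^ 2 - 2 * area a b z r t) * dl a b z x t ≤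
      enclosedVolume a b z r t :=
    integral_mono_on hab.le ((continuousOn_const.mul hz).intervalIntegrable_of_Icc hab.le)
      (((hr.pow 2).mul hz).intervalIntegrable_of_Icc hab.le)
      fun x hx => mul_le_mul_of_nonneg_right (hle x hx) (F.dz_pos x hx t ht').le
  rw [intervalIntegral.integral_const_mul, hftc, ← le_div_iff₀ (sub_pos.2 hab)] at h
  linarith

/-- Integrate `h = f + k + p` against `r² dz`, where `f = h - H`. By parts the `k` term becomes `2
sin² θ` against the area element and the `p` term is `cos² θ`, together at most `2`; the `f` term is
split by `f ≤ η + f² / η`. -/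
lemma avgMeanCurv_mul_enclosedVolume_le (hab : a < b) (F : IsFlow a b T ρ₀ z r)
    (ht : t ∈ Ioo 0 T) {R η : ℝ} (hR : ∀ l ∈ Icc a b, r l t ≤ R) (hη : 0 < η) :
    avgMeanCurv a b z r t * enclosedVolume a b z r t ≤
      (2 + R * η) * area a b z r t + R / η * dissipation a b z r t := by
  have ht' := Ioo_subset_Ico_self ht
  have hc := F.continuousOn_normalSpeed hab ht
  have hA := (F.smooth_areaElement hab).slice_continuousOn ht
  have hr := F.smoothStrip_r.slice_continuousOn ht
  have hz := (F.smoothStrip_z.dl hab).slice_continuousOn ht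
  have hs := (F.smooth_sinAngle hab).slice_continuousOn ht
  have hvs := ((F.smooth_speed hab).mul (F.smooth_sinAngle hab)).slice_continuousOn ht
  have hvk := (((F.smooth_speed hab).mul (F.smooth_curvK hab)).mul
    (F.smooth_cosAngle hab)).slice_continuousOn ht
  have hcont : ContinuousOn (fun l =>
      2 * r l t * (speed a b z r l t * sinAngle a b z r l t) * sinAngle a b z r l t -
        r l t ^ 2 * (speed a b z r l t * curvK a b z r l t * cosAngle a b z r l t)) (Icc a b) :=
    (((continuousOn_const.mul hr).mul hvs).mul hs).sub ((hr.pow 2).mul hvk)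
  have hftc := integral_eq_sub_of_hasDerivWithinAt_Icc hab.le
    (f := fun l => r l t ^ 2 * sinAngle a b z r l t)
    (fun l hl => (((F.hasDeriv_r hl ht).pow 2).mul (F.hasDeriv_sinAngle hab hl ht)).congr_deriv
      (by simp only [Pi.pow_apply]; push_cast; ring)) hcont
  rw [F.sinAngle_eq_zero (Or.inl rfl) ht', F.sinAngle_eq_zero (Or.inr rfl) ht', mul_zero,
    mul_zero, sub_zero] at hftc
  have i1 : IntervalIntegrable (fun l => (2 + R * η) * (r l t * speed a b z r l t)) volume a b :=
    (continuousOn_const.mul hA).intervalIntegrable_of_Icc hab.le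
  have i2 : IntervalIntegrable (fun l => R / η *
      (normalSpeed a b z r l t ^ 2 * (r l t * speed a b z r l t))) volume a b :=
    (continuousOn_const.mul ((hc.pow 2).mul hA)).intervalIntegrable_of_Icc hab.le
  have i3 := hcont.intervalIntegrable_of_Icc (μ := volume) hab.le
  have i4 : IntervalIntegrable (fun l => avgMeanCurv a b z r t * (r l t ^ 2 * dl a b z l t))
      volume a b := (continuousOn_const.mul ((hr.pow 2).mul hz)).intervalIntegrable_of_Icc hab.le
  rw [area, dissipation, enclosedVolume, ← intervalIntegral.integral_const_mul,
    ← intervalIntegral.integral_const_mul, ← intervalIntegral.integral_const_mul,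
    ← sub_zero (_ + _), ← hftc, ← intervalIntegral.integral_add i1 i2,
    ← intervalIntegral.integral_sub (i1.add i2) i3]
  refine integral_mono_on hab.le i4 ((i1.add i2).sub i3) fun l hl => ?_
  have hrp := F.r_pos l hl t ht'
  have hcp := F.cosAngle_pos hl ht'
  have hv := F.speed_pos hl ht'
  have hcs := F.cos_sq_add_sin_sq hl ht'
  have hf : normalSpeed a b z r l t ≤ η + normalSpeed a b z r l t ^ 2 / η := by
    have : η + normalSpeed a b z r l t ^ 2 / η - normalSpeed a b z r l t =
        ((normalSpeed a b z r l t - η / 2) ^ 2 + 3 / 4 * η ^ 2) / η := by field_simp; ring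
    have : 0 ≤ ((normalSpeed a b z r l t - η / 2) ^ 2 + 3 / 4 * η ^ 2) / η := by positivity
    linarith
  have hf0 : 0 ≤ η + normalSpeed a b z r l t ^ 2 / η := by positivity
  have h1 : normalSpeed a b z r l t * (r l t * cosAngle a b z r l t) ≤
      (η + normalSpeed a b z r l t ^ 2 / η) * R := by
    refine (mul_le_mul_of_nonneg_right hf (by positivity)).trans
      (mul_le_mul_of_nonneg_left ?_ hf0)
    exact (mul_le_of_le_one_right hrp.le (F.cosAngle_le hl ht')).trans (hR l hl)
  have h2 := mul_le_mul_of_nonneg_right h1 (mul_pos hrp hv).le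
  have hh : avgMeanCurv a b z r t = normalSpeed a b z r l t + curvK a b z r l t +
      cosAngle a b z r l t / r l t := by rw [← curvP_eq, normalSpeed, meanCurv]; ring
  have h3 : 0 ≤ r l t * speed a b z r l t * cosAngle a b z r l t ^ 2 := by positivity
  rw [F.dl_z hl ht', hh]
  have e1 : (normalSpeed a b z r l t + curvK a b z r l t + cosAngle a b z r l t / r l t) *
      (r l t ^ 2 * (speed a b z r l t * cosAngle a b z r l t)) =
      normalSpeed a b z r l t * (r l t * cosAngle a b z r l t) * (r l t * speed a b z r l t) +
      r l t ^ 2 * (speed a b z r l t * curvK a b z r l t * cosAngle a b z r l t) +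
      r l t * speed a b z r l t * cosAngle a b z r l t ^ 2 := by
    field_simp
  have e2 : (η + normalSpeed a b z r l t ^ 2 / η) * R * (r l t * speed a b z r l t) =
      R * η * (r l t * speed a b z r l t) +
      R / η * (normalSpeed a b z r l t ^ 2 * (r l t * speed a b z r l t)) := by
    field_simp
  have e3 : sinAngle a b z r l t ^ 2 = 1 - cosAngle a b z r l t ^ 2 := by linarith
  have e4 : 2 * r l t * (speed a b z r l t * sinAngle a b z r l t) * sinAngle a b z r l t =
      2 * (r l t * speed a b z r l t) * (1 - cosAngle a b z r l t ^ 2) := by rw [← e3]; ring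
  rw [e1, e4]
  linarith

/-- A bound of the average of the mean curvature by a constant and the dissipation. -/
lemma exists_avgMeanCurv_le (hab : a < b) (F : IsFlow a b T ρ₀ z r) {t₁ : ℝ}
    (ht₁ : t₁ ∈ Ioo 0 T) :
    ∃ c : ℝ, 0 < c ∧ ∀ t ∈ Ico t₁ T, ∀ η : ℝ, 0 < η →
      avgMeanCurv a b z r t ≤ c * (1 + η + dissipation a b z r t / η) := by
  set W := enclosedVolume a b z r t₁
  set A := area a b z r t₁
  have hW : 0 < W := F.enclosedVolume_pos hab ht₁
  have hA : 0 < A := F.area_pos hab ht₁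
  have hba := sub_pos.2 hab
  -- Bounds the radius at all later times, as the volume stays `W` and the area stays at most `A`.
  set R := Real.sqrt (W / (b - a) + 2 * A) with hRdef
  have hR : 0 < R := Real.sqrt_pos.2 (by positivity)
  refine ⟨(2 * A + R * A + R) / W, by positivity, fun t ht η hη => ?_⟩
  have ht' : t ∈ Ioo 0 T := ⟨ht₁.1.trans_le ht.1, ht.2⟩
  have hWt : enclosedVolume a b z r t = W := F.enclosedVolume_const hab ht' ht₁
  have hAt : area a b z r t ≤ A := F.area_antitoneOn hab ht₁ ht' ht.1
  have hD := F.dissipation_nonneg hab ht'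
  have h := F.avgMeanCurv_mul_enclosedVolume_le hab ht' (R := R) (fun l hl =>
    Real.le_sqrt_of_sq_le ((F.r_sq_le hab hl ht').trans (by rw [hWt]; linarith))) hη
  rw [hWt, ← le_div_iff₀ hW] at h
  refine h.trans ?_
  rw [div_mul_eq_mul_div (2 * A + R * A + R)]
  gcongr
  have h1 : (2 + R * η) * area a b z r t ≤ (2 + R * η) * A := by gcongr
  have h2 : 0 ≤ dissipation a b z r t / η := by positivity
  have h3 : R / η * dissipation a b z r t = R * (dissipation a b z r t / η) := by ring
  rw [h3]
  have h4 : 0 ≤ (2 * A + R * A) * (dissipation a b z r t / η) := by positivity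
  have h5 : 0 ≤ (2 * A + R) * η := by positivity
  have h6 : 0 ≤ R * A + R := by positivity
  nlinarith

end IsFlow
end AxialFlow

/-! ### The maximum principle for the quotient of the principal curvatures. -/

namespace AxialFlow

open Filter Topology

/-- The second derivative test at a maximum over an interval, valid also at its end points if the
first derivative vanishes. -/
lemma second_deriv_nonpos_of_isMaxOn_Icc {a b l c : ℝ} (hab : a < b) {φ φ' : ℝ → ℝ}
    (hl : l ∈ Icc a b) (hmax : IsMaxOn φ (Icc a b) l)
    (hφ : ∀ s ∈ Icc a b, HasDerivWithinAt φ (φ' s) (Icc a b) s)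
    (hφ' : HasDerivWithinAt φ' c (Icc a b) l) (h0 : φ' l = 0) : c ≤ 0 := by
  by_contra! hc
  have h1 := (hasDerivWithinAt_iff_tendsto_slope.1 hφ').eventually_const_lt hc
  obtain ⟨δ, hδ, hball⟩ := Metric.mem_nhdsWithin_iff.1 h1
  have hpos : ∀ s ∈ Icc a b, s ≠ l → |s - l| < δ → 0 < φ' s / (s - l) := by
    intro s hs hne hsl
    have : 0 < slope φ' l s := hball ⟨by simpa [Real.dist_eq] using hsl, hs, hne⟩
    rwa [slope_def_field, h0, sub_zero] at this
  have hcont : ContinuousOn φ (Icc a b) := fun s hs => (hφ s hs).continuousWithinAt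
  have hder : ∀ s ∈ Ioo a b, HasDerivAt φ (φ' s) s := fun s hs =>
    (hφ s (Ioo_subset_Icc_self hs)).hasDerivAt (Icc_mem_nhds hs.1 hs.2)
  -- If `c > 0`, `φ'` has the sign of `s - l` near `l`. A one-sided mean value argument inside the
  -- interval then contradicts maximality; the left side is used only at the end point `b`.
  rcases hl.2.lt_or_eq with hlb | hlb
  · set s := min b (l + δ / 2)
    have hs1 : l < s := lt_min hlb (by linarith)
    have hs2 : s ≤ b := min_le_left _ _
    have hs3 : s ≤ l + δ / 2 := min_le_right _ _
    obtain ⟨x, hx, hxe⟩ := exists_hasDerivAt_eq_slope φ φ' hs1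
      (hcont.mono (Icc_subset_Icc hl.1 hs2))
      (fun x hx => hder x ⟨hl.1.trans_lt hx.1, hx.2.trans_le hs2⟩)
    have hxp := hpos x ⟨hl.1.trans hx.1.le, hx.2.le.trans hs2⟩ hx.1.ne'
      (by rw [abs_of_pos (sub_pos.2 hx.1)]; linarith [hx.2])
    have h2 : 0 < φ' x := by
      by_contra! h
      exact absurd hxp (not_lt.2 (div_nonpos_of_nonpos_of_nonneg h (sub_nonneg.2 hx.1.le)))
    have h3 : φ s ≤ φ l := hmax ⟨hl.1.trans hs1.le, hs2⟩
    rw [hxe] at h2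
    exact absurd h2 (not_lt.2 (div_nonpos_of_nonpos_of_nonneg (sub_nonpos.2 h3)
      (sub_nonneg.2 hs1.le)))
  · have hal : a < l := hlb ▸ hab
    set s := max a (l - δ / 2)
    have hs1 : s < l := max_lt hal (by linarith)
    have hs2 : a ≤ s := le_max_left _ _
    have hs3 : l - δ / 2 ≤ s := le_max_right _ _
    obtain ⟨x, hx, hxe⟩ := exists_hasDerivAt_eq_slope φ φ' hs1
      (hcont.mono (Icc_subset_Icc hs2 hl.2))
      (fun x hx => hder x ⟨hs2.trans_lt hx.1, hx.2.trans_le hl.2⟩)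
    have hxp := hpos x ⟨hs2.trans hx.1.le, hx.2.le.trans hl.2⟩ hx.2.ne
      (by rw [abs_of_neg (sub_neg.2 hx.2)]; linarith [hx.1])
    have h2 : φ' x < 0 := by
      by_contra! h
      exact absurd hxp (not_lt.2 (div_nonpos_of_nonneg_of_nonpos h (sub_nonpos.2 hx.2.le)))
    have h3 : φ s ≤ φ l := hmax ⟨hs2, hs1.le.trans hl.2⟩
    rw [hxe] at h2
    exact absurd h2 (not_lt.2 (div_nonneg (sub_nonneg.2 h3) (sub_nonneg.2 hs1.le)))

lemma derivWithin_eq_zero_of_isMaxOn_Ioo {a b l : ℝ} {φ : ℝ → ℝ} (hl : l ∈ Ioo a b)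
    (hmax : IsMaxOn φ (Icc a b) l) : derivWithin φ (Icc a b) l = 0 := by
  have hn := Icc_mem_nhds hl.1 hl.2
  rw [derivWithin_of_mem_nhds hn]
  exact (hmax.isLocalMax hn).deriv_eq_zero

/-- The quotient of the principal curvatures. -/
noncomputable def curvRatio (a b : ℝ) (z r : ℝ → ℝ → ℝ) (l t : ℝ) : ℝ :=
  curvK a b z r l t / curvP a b z r l t

namespace IsFlow

variable {a b T : ℝ} {ρ₀ : ℝ → ℝ} {z r : ℝ → ℝ → ℝ} {l t : ℝ}

lemma smooth_curvRatio (hab : a < b) (F : IsFlow a b T ρ₀ z r) :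
    SmoothStrip a b T (curvRatio a b z r) :=
  (F.smooth_curvK hab).div (F.smooth_curvP hab)
    (fun _ hl _ ht => (F.curvP_pos hl (Ioo_subset_Ico_self ht)).ne')

lemma curvK_eq (F : IsFlow a b T ρ₀ z r) (hl : l ∈ Icc a b) (ht : t ∈ Ico 0 T) :
    curvK a b z r l t = curvRatio a b z r l t * curvP a b z r l t :=
  (div_mul_cancel₀ _ (F.curvP_pos hl ht).ne').symm

/-- With `Q = k / p` one has `H = (Q + 1) p`, and Codazzi reads `p_s = (r_s / r) (Q - 1) p`. -/
lemma ds_meanCurv (hab : a < b) (F : IsFlow a b T ρ₀ z r) (hl : l ∈ Icc a b) (ht : t ∈ Ioo 0 T) :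
    ds a b z r (meanCurv a b z r) l t =
      ds a b z r (curvRatio a b z r) l t * curvP a b z r l t +
      (curvRatio a b z r l t ^ 2 - 1) * (sinAngle a b z r l t / r l t * curvP a b z r l t) := by
  have hv := F.speed_pos hl (Ioo_subset_Ico_self ht)
  have h : dl a b (meanCurv a b z r) l t = _ :=
    (((((F.smooth_curvRatio hab).hasDerivWithinAt_dl hl ht).mul
    (F.hasDeriv_curvP hab hl ht)).add (F.hasDeriv_curvP hab hl ht)).congr_of_mem
    (f₁ := fun s => meanCurv a b z r s t) (fun s hs => by
      rw [meanCurv, F.curvK_eq hs (Ioo_subset_Ico_self ht)]; rfl) hl).derivWithin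
        (uniqueDiffOn_Icc hab l hl)
  rw [ds, h, F.curvK_eq hl (Ioo_subset_Ico_self ht), ds]
  field_simp
  ring

lemma hasDeriv_sinAngle_div_r (hab : a < b) (F : IsFlow a b T ρ₀ z r) (hl : l ∈ Icc a b)
    (ht : t ∈ Ioo 0 T) :
    HasDerivWithinAt (fun s => sinAngle a b z r s t / r s t)
      (-(speed a b z r l t * (curvK a b z r l t * curvP a b z r l t +
        (sinAngle a b z r l t / r l t) ^ 2))) (Icc a b) l := by
  have hr := F.r_pos l hl t (Ioo_subset_Ico_self ht)
  refine ((F.hasDeriv_sinAngle hab hl ht).div (F.hasDeriv_r hl ht) hr.ne').congr_deriv ?_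
  rw [curvP_eq]
  field_simp
  ring

/-- At a critical point of the quotient of the principal curvatures. -/
lemma ds_ds_meanCurv (hab : a < b) (F : IsFlow a b T ρ₀ z r) (hl : l ∈ Icc a b)
    (ht : t ∈ Ioo 0 T) (h0 : dl a b (curvRatio a b z r) l t = 0) :
    ds a b z r (ds a b z r (meanCurv a b z r)) l t =
      dl a b (dl a b (curvRatio a b z r)) l t / speed a b z r l t ^ 2 * curvP a b z r l t +
      curvP a b z r l t * (curvRatio a b z r l t ^ 2 - 1) *
        (-curvRatio a b z r l t * curvP a b z r l t ^ 2 +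
          (sinAngle a b z r l t / r l t) ^ 2 * (curvRatio a b z r l t - 2)) := by
  have hv := F.speed_pos hl (Ioo_subset_Ico_self ht)
  have hQ := (F.smooth_curvRatio hab).hasDerivWithinAt_dl hl ht
  have hQs := (((F.smooth_curvRatio hab).dl hab).hasDerivWithinAt_dl hl ht).div
    (F.hasDeriv_speed hab hl ht) hv.ne'
  have hp := F.hasDeriv_curvP hab hl ht
  have hq := F.hasDeriv_sinAngle_div_r hab hl ht
  have h : dl a b (ds a b z r (meanCurv a b z r)) l t = _ :=
    (((hQs.mul hp).add (((hQ.pow 2).sub_const 1).mul (hq.mul hp))).congr_of_mem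
      (fun s hs => F.ds_meanCurv hab hs ht) hl).derivWithin (uniqueDiffOn_Icc hab l hl)
  rw [ds, h]
  simp only [Pi.mul_apply, Pi.div_apply, Pi.pow_apply, h0, F.curvK_eq hl (Ioo_subset_Ico_self ht)]
  generalize sinAngle a b z r l t / r l t = q
  field_simp
  ring

/-- Criticality drops the gradient terms. For `Q = k / p ≥ 1` and `h ≥ 0` both remaining reaction
terms are nonpositive. -/
lemma evolution_curvRatio (hab : a < b) (F : IsFlow a b T ρ₀ z r) (hl : l ∈ Icc a b)
    (ht : t ∈ Ioo 0 T) (h0 : dl a b (curvRatio a b z r) l t = 0) :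
    HasDerivAt (fun s => curvRatio a b z r l s)
      (dl a b (dl a b (curvRatio a b z r)) l t / speed a b z r l t ^ 2 -
        2 * (sinAngle a b z r l t / r l t) ^ 2 * (curvRatio a b z r l t ^ 2 - 1) -
        avgMeanCurv a b z r t * curvP a b z r l t *
          (curvRatio a b z r l t * (curvRatio a b z r l t - 1))) t := by
  have ht' := Ioo_subset_Ico_self ht
  have hp := F.curvP_pos hl ht'
  have hk := F.curvK_eq hl ht'
  refine ((F.evolution_curvK hab hl ht).div (F.evolution_curvP hab hl ht) hp.ne').congr_deriv ?_
  change (_ * _ - _ * (ds a b z r (meanCurv a b z r) l t * _ - _)) / _ = _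
  rw [F.ds_ds_meanCurv hab hl ht h0, F.ds_meanCurv hab hl ht]
  have h1 : ds a b z r (curvRatio a b z r) l t = 0 := by rw [ds, h0, zero_div]
  rw [h1, normalSpeed, meanCurv, hk]
  generalize sinAngle a b z r l t / r l t = q
  generalize dl a b (dl a b (curvRatio a b z r)) l t / speed a b z r l t ^ 2 = D
  field_simp
  ring

/-- The sine vanishes at the end points for all times, so its time derivative `-H_s cos θ` does too;
then `H_s = 0`, and `ds_meanCurv` leaves only the derivative of the quotient. -/
lemma dl_curvRatio_eq_zero (hab : a < b) (F : IsFlow a b T ρ₀ z r) (hl : l = a ∨ l = b)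
    (ht : t ∈ Ioo 0 T) : dl a b (curvRatio a b z r) l t = 0 := by
  have hl' : l ∈ Icc a b := by
    rcases hl with rfl | rfl
    exacts [left_mem_Icc.2 hab.le, right_mem_Icc.2 hab.le]
  have ht' := Ioo_subset_Ico_self ht
  have hv := F.speed_pos hl' ht'
  have hp := F.curvP_pos hl' ht'
  have hc := F.cosAngle_pos hl' ht'
  have hev : (fun s => sinAngle a b z r l s) =ᶠ[𝓝 t] fun _ => 0 := by
    filter_upwards [Ioo_mem_nhds ht.1 ht.2] with s hs
    exact F.sinAngle_eq_zero hl (Ioo_subset_Ico_self hs)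
  have h1 := (F.evolution_sinAngle hab hl' ht).unique
    ((hasDerivAt_const t (0 : ℝ)).congr_of_eventuallyEq hev)
  have h2 : ds a b z r (meanCurv a b z r) l t = 0 :=
    (mul_eq_zero.1 (neg_eq_zero.1 h1)).resolve_right hc.ne'
  rw [F.ds_meanCurv hab hl' ht, F.sinAngle_eq_zero hl ht', zero_div, zero_mul, mul_zero, add_zero,
    ds] at h2
  exact (div_eq_zero_iff.1 ((mul_eq_zero.1 h2).resolve_right hp.ne')).resolve_right hv.ne'

lemma dt_curvRatio_nonpos (hab : a < b) (F : IsFlow a b T ρ₀ z r) (hl : l ∈ Icc a b)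
    (ht : t ∈ Ioo 0 T) (hmax : IsMaxOn (fun s => curvRatio a b z r s t) (Icc a b) l)
    (hge : 1 ≤ curvRatio a b z r l t) : dt (curvRatio a b z r) l t ≤ 0 := by
  have ht' := Ioo_subset_Ico_self ht
  have hp := F.curvP_pos hl ht'
  have h0 : dl a b (curvRatio a b z r) l t = 0 := by
    rcases eq_or_lt_of_le hl.1 with h | h
    · exact F.dl_curvRatio_eq_zero hab (Or.inl h.symm) ht
    rcases eq_or_lt_of_le hl.2 with h' | h'
    · exact F.dl_curvRatio_eq_zero hab (Or.inr h') ht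
    · exact derivWithin_eq_zero_of_isMaxOn_Ioo ⟨h, h'⟩ hmax
  have h2 : dl a b (dl a b (curvRatio a b z r)) l t ≤ 0 :=
    second_deriv_nonpos_of_isMaxOn_Icc hab hl hmax
      (fun s hs => (F.smooth_curvRatio hab).hasDerivWithinAt_dl hs ht)
      (((F.smooth_curvRatio hab).dl hab).hasDerivWithinAt_dl hl ht) h0
  have hh := F.avgMeanCurv_nonneg hab ht
  have e1 : dl a b (dl a b (curvRatio a b z r)) l t / speed a b z r l t ^ 2 ≤ 0 :=
    div_nonpos_of_nonpos_of_nonneg h2 (sq_nonneg _)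
  have e2 : 0 ≤ 2 * (sinAngle a b z r l t / r l t) ^ 2 * (curvRatio a b z r l t ^ 2 - 1) :=
    mul_nonneg (by positivity) (by nlinarith)
  have e3 : 0 ≤ avgMeanCurv a b z r t * curvP a b z r l t *
      (curvRatio a b z r l t * (curvRatio a b z r l t - 1)) :=
    mul_nonneg (mul_nonneg hh hp.le) (mul_nonneg (by linarith) (by linarith))
  have h3 : dt (curvRatio a b z r) l t = _ := (F.evolution_curvRatio hab hl ht h0).deriv
  rw [h3]
  linarith

lemma exists_curvK_le_mul_curvP (hab : a < b) (F : IsFlow a b T ρ₀ z r) {t₁ : ℝ}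
    (ht₁ : t₁ ∈ Ioo 0 T) :
    ∃ C : ℝ, 1 ≤ C ∧ ∀ t ∈ Ico t₁ T, ∀ l ∈ Icc a b,
      curvK a b z r l t ≤ C * curvP a b z r l t := by
  have hQ := F.smooth_curvRatio hab
  obtain ⟨K, hK⟩ := isCompact_Icc.exists_bound_of_continuousOn (hQ.slice_continuousOn ht₁)
  refine ⟨max 1 K, le_max_left _ _, fun t₂ ht₂ l₂ hl₂ => ?_⟩
  have hIoo : ∀ s ∈ Icc t₁ t₂, s ∈ Ioo 0 T :=
    fun s hs => ⟨ht₁.1.trans_le hs.1, hs.2.trans_lt ht₂.2⟩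
  rw [F.curvK_eq hl₂ ⟨(ht₁.1.trans_le ht₂.1).le, ht₂.2⟩]
  refine mul_le_mul_of_nonneg_right ?_ (F.curvP_pos hl₂ ⟨(ht₁.1.trans_le ht₂.1).le, ht₂.2⟩).le
  by_contra! hlt
  -- Subtracting `ε (t - t₁)` turns the weak inequality `dt ≤ 0` at a maximum into a strict one; `ε`
  -- is small enough to keep the maximum above `max 1 K`.
  obtain ⟨ε, hε, hεlt⟩ : ∃ ε : ℝ, 0 < ε ∧
      max 1 K < curvRatio a b z r l₂ t₂ - ε * (t₂ - t₁) := by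
    refine ⟨(curvRatio a b z r l₂ t₂ - max 1 K) / (2 * (t₂ - t₁ + 1)), ?_, ?_⟩
    · have := ht₂.1
      exact div_pos (sub_pos.2 hlt) (by linarith)
    · have h1 := sub_nonneg.2 ht₂.1
      rw [lt_sub_comm, div_mul_eq_mul_div, div_lt_iff₀ (by linarith)]
      nlinarith [mul_nonneg h1 (sub_pos.2 hlt).le]
  have hcont : ContinuousOn (fun P : ℝ × ℝ => curvRatio a b z r P.1 P.2 - ε * (P.2 - t₁))
      (Icc a b ×ˢ Icc t₁ t₂) :=
    (hQ.continuousOn.mono (prod_mono le_rfl hIoo)).sub (by fun_prop)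
  obtain ⟨⟨l, t⟩, hlt', hmax⟩ := (isCompact_Icc.prod isCompact_Icc).exists_isMaxOn
    ⟨(l₂, t₂), hl₂, right_mem_Icc.2 ht₂.1⟩ hcont
  have hl : l ∈ Icc a b := hlt'.1
  have ht : t ∈ Icc t₁ t₂ := hlt'.2
  have hmax' : ∀ s ∈ Icc a b, ∀ τ ∈ Icc t₁ t₂,
      curvRatio a b z r s τ - ε * (τ - t₁) ≤ curvRatio a b z r l t - ε * (t - t₁) :=
    fun s hs τ hτ => isMaxOn_iff.1 hmax (s, τ) ⟨hs, hτ⟩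
  have hval := hεlt.trans_le (hmax' l₂ hl₂ t₂ (right_mem_Icc.2 ht₂.1))
  have hne : t₁ < t := by
    refine lt_of_le_of_ne ht.1 fun h => ?_
    have h1 := (le_abs_self _).trans (hK l hl)
    rw [← h, sub_self, mul_zero, sub_zero] at hval
    exact absurd (hval.trans_le h1) (not_lt.2 (le_max_right _ _))
  have hge : 1 ≤ curvRatio a b z r l t := by
    have := mul_nonneg hε.le (sub_nonneg.2 ht.1)
    linarith [le_max_left 1 K]
  have hdt := F.dt_curvRatio_nonpos hab hl (hIoo t ht)
    (isMaxOn_iff.2 fun s hs => by linarith [hmax' s hs t ht]) hge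
  have hd : HasDerivAt (fun s => curvRatio a b z r l s - ε * s)
      (dt (curvRatio a b z r) l t - ε * 1) t :=
    (hQ.hasDerivAt_dt hl (hIoo t ht)).sub ((hasDerivAt_id t).const_mul ε)
  have hneg : dt (curvRatio a b z r) l t - ε * 1 < 0 := by linarith
  -- Only earlier times are compared, since the maximum may lie at the final time `t₂`.
  have hslope := ((hasDerivAt_iff_tendsto_slope.1 hd).eventually_lt_const hneg).filter_mono
    (nhdsWithin_mono t (s := Iio t) fun _ hs => ne_of_lt hs)
  obtain ⟨s, hs, hs'⟩ := (hslope.and (Ioo_mem_nhdsLT hne)).exists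
  rw [slope_def_field] at hs
  have h1 := hmax' l hl s ⟨hs'.1.le, hs'.2.le.trans ht.2⟩
  refine absurd hs (not_lt.2 (div_nonneg_of_nonpos ?_ (sub_nonpos.2 hs'.2.le)))
  linarith

end IsFlow
end AxialFlow

/-! ### The lower barrier for the radius. -/

namespace AxialFlow

open Filter Topology

namespace IsFlow

variable {a b T : ℝ} {ρ₀ : ℝ → ℝ} {z r : ℝ → ℝ → ℝ} {l t : ℝ}

/-- Turns the boundary hypothesis into openness: small radii before `T` cannot occur on the frontier
of `S`. -/
lemma mem_interior_of_r_lt {c : ℝ} {S : Set (Param a b × ℝ)}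
    (hy : ∀ P ∈ parabolicBoundary T S, c ≤ r P.1.1 P.2) {P : Param a b × ℝ}
    (hP : P ∈ closure S) (hPT : P.2 < T) (hr : r P.1.1 P.2 < c) : P ∈ interior S := by
  by_contra h
  exact absurd (hy P ⟨⟨hP, h⟩, hPT.ne⟩) (not_le.2 hr)

lemma curvP_eq_of_isLocalMinOn (F : IsFlow a b T ρ₀ z r) (hl : l ∈ Icc a b)
    (ht : t ∈ Ico 0 T) (hmin : IsLocalMinOn (fun s => r s t) (Icc a b) l) :
    cosAngle a b z r l t = 1 ∧ curvP a b z r l t = 1 / r l t := by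
  have h0 : sinAngle a b z r l t = 0 := by
    rcases eq_or_lt_of_le hl.1 with h | h
    · exact F.sinAngle_eq_zero (Or.inl h.symm) ht
    rcases eq_or_lt_of_le hl.2 with h' | h'
    · exact F.sinAngle_eq_zero (Or.inr h') ht
    · have hn := Icc_mem_nhds h h'
      rw [sinAngle, dl, derivWithin_of_mem_nhds hn, (hmin.isLocalMin hn).deriv_eq_zero, zero_div]
  have h1 := F.cos_sq_add_sin_sq hl ht
  have h2 := F.cosAngle_pos hl ht
  have h3 : cosAngle a b z r l t = 1 := by
    rw [h0] at h1
    nlinarith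
  exact ⟨h3, by rw [curvP_eq, h3]⟩

/-- A barrier for the minimal radius over `S`. -/
lemma exists_r_le_barrier (F : IsFlow a b T ρ₀ z r) {κ c : ℝ} {S : Set (Param a b × ℝ)}
    (hS : ∀ P ∈ S, κ * curvP a b z r P.1.1 P.2 ≤ meanCurv a b z r P.1.1 P.2)
    (hy : ∀ P ∈ parabolicBoundary T S, c ≤ r P.1.1 P.2) {t₀ t₁ : ℝ} (ht₀ : 0 < t₀)
    (ht₁ : t₁ < T) {B B' : ℝ → ℝ} (hB : ∀ t ∈ Icc t₀ t₁, HasDerivAt B (B' t) t)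
    (hBc : ∀ t ∈ Icc t₀ t₁, B t < c)
    (hB' : ∀ t ∈ Icc t₀ t₁, 0 < B t → avgMeanCurv a b z r t - κ / B t < B' t)
    {m₀ : Param a b} (hm₀ : (m₀, t₀) ∈ S) (hr₀ : r m₀.1 t₀ ≤ B t₀) :
    ∀ t ∈ Icc t₀ t₁, ∃ m : Param a b, (m, t) ∈ S ∧ r m.1 t ≤ B t := by
  have hIoo : ∀ t ∈ Icc t₀ t₁, t ∈ Ioo 0 T :=
    fun t ht => ⟨ht₀.trans_le ht.1, ht.2.trans_lt ht₁⟩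
  have hBcont : ContinuousOn B (Icc t₀ t₁) := fun t ht => (hB t ht).continuousAt.continuousWithinAt
  -- Continuous induction: the good times form a closed set that extends to the right of each of its
  -- points.
  refine IsClosed.Icc_subset_of_forall_exists_gt
    (s := {t | ∃ m : Param a b, (m, t) ∈ S ∧ r m.1 t ≤ B t}) ?_ ⟨m₀, hm₀, hr₀⟩ ?_
  -- Limits of good points lie in the closure of `S`; as `B < c`, they are in fact in `S`.
  -- Compactness then makes the set of times closed.
  · set D : Set (Param a b × ℝ) := univ ×ˢ Icc t₀ t₁ with hD
    have hDc : IsCompact D := isCompact_univ.prod isCompact_Icc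
    have hrc : ContinuousOn (fun P : Param a b × ℝ => r P.1.1 P.2) D :=
      F.smoothStrip_r.continuousOn.comp (f := fun P : Param a b × ℝ => ((P.1.1 : ℝ), P.2))
        (by fun_prop) (fun P hP => ⟨P.1.1.2, hIoo _ hP.2⟩)
    have hBc' : ContinuousOn (fun P : Param a b × ℝ => B P.2) D :=
      hBcont.comp continuousOn_snd (fun P hP => hP.2)
    have hcl : IsClosed {P ∈ D | r P.1.1 P.2 ≤ B P.2} := hDc.isClosed.isClosed_le hrc hBc'
    have hK : IsCompact ({P ∈ D | r P.1.1 P.2 ≤ B P.2} ∩ closure S) :=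
      hDc.of_isClosed_subset (hcl.inter isClosed_closure) fun P hP => hP.1.1
    have himg : {t | ∃ m : Param a b, (m, t) ∈ S ∧ r m.1 t ≤ B t} ∩ Icc t₀ t₁ =
        Prod.snd '' ({P ∈ D | r P.1.1 P.2 ≤ B P.2} ∩ closure S) := by
      ext t
      constructor
      · rintro ⟨⟨m, hm, hr⟩, ht⟩
        exact ⟨(m, t), ⟨⟨⟨mem_univ _, ht⟩, hr⟩, subset_closure hm⟩, rfl⟩
      · rintro ⟨⟨m, s⟩, ⟨⟨⟨-, hs⟩, hr⟩, hm⟩, rfl⟩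
        exact ⟨⟨m, interior_subset (mem_interior_of_r_lt hy hm (hIoo s hs).2
          (hr.trans_lt (hBc s hs))), hr⟩, hs⟩
    rw [himg]
    exact (hK.image continuous_snd).isClosed
  · rintro t ⟨⟨m₁, hm₁, hr₁⟩, ht⟩ y hy'
    have htI : t ∈ Icc t₀ t₁ := Ico_subset_Icc_self ht
    have htT := hIoo t htI
    have hnhds : ∀ m : Param a b, (m, t) ∈ S → r m.1 t ≤ B t → S ∈ 𝓝 (m, t) := fun m hm hr =>
      mem_interior_iff_mem_nhds.1 (mem_interior_of_r_lt hy (subset_closure hm) htT.2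
        (hr.trans_lt (hBc t htI)))
    suffices h : ∃ m : Param a b, (m, t) ∈ S ∧ r m.1 t ≤ B t ∧ ∀ᶠ s in 𝓝[>] t, r m.1 s < B s by
      obtain ⟨m, hm, hr, hev⟩ := h
      have hmS : ∀ᶠ s in 𝓝[>] t, (m, s) ∈ S :=
        ((Continuous.prodMk_right m).continuousAt.eventually_mem
          (hnhds m hm hr)).filter_mono nhdsWithin_le_nhds
      obtain ⟨s, ⟨hs1, hs2⟩, hs3⟩ := ((hev.and hmS).and (Ioc_mem_nhdsGT hy')).exists
      exact ⟨s, ⟨m, hs2, hs1.le⟩, hs3⟩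
    by_cases hlt : ∃ m : Param a b, (m, t) ∈ S ∧ r m.1 t < B t
    · obtain ⟨m, hm, hr⟩ := hlt
      exact ⟨m, hm, hr.le, ((F.evolution_r m.1.2 htT).continuousAt.eventually_lt
        (hB t htI).continuousAt hr).filter_mono nhdsWithin_le_nhds⟩
    · push Not at hlt
      -- No point of the slice is strictly below `B`, so `m₁` realises the least radius; `S` being a
      -- neighbourhood, this is a local minimum, where `r' = h - H ≤ h - κ / B < B'`.
      have heq : r m₁.1 t = B t := le_antisymm hr₁ (hlt m₁ hm₁)
      refine ⟨m₁, hm₁, hr₁, ?_⟩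
      have hmin : IsLocalMinOn (fun s => r s t) (Icc a b) m₁.1 := by
        refine (eventually_nhds_subtype_iff (Icc a b) m₁.1
          (fun s => r m₁.1 t ≤ r s t)).1 ?_
        have hc : Continuous fun x : Icc a b => (((x, m₁.2), t) : Param a b × ℝ) := by fun_prop
        filter_upwards [hc.continuousAt.eventually_mem (hnhds m₁ hm₁ hr₁)] with x hx
        rw [heq]
        exact hlt (x, m₁.2) hx
      obtain ⟨hcos, hp⟩ := F.curvP_eq_of_isLocalMinOn m₁.1.2 (Ioo_subset_Ico_self htT) hmin
      have hpos := F.r_pos m₁.1 m₁.1.2 t (Ioo_subset_Ico_self htT)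
      have hd := (F.evolution_r m₁.1.2 htT).sub (hB t htI)
      have hH := hS _ hm₁
      simp only [hp, mul_one_div, heq] at hH
      have hneg : normalSpeed a b z r m₁.1 t * cosAngle a b z r m₁.1 t - B' t < 0 := by
        have := hB' t htI (heq ▸ hpos)
        rw [hcos, normalSpeed]
        linarith
      have hslope := ((hasDerivAt_iff_tendsto_slope.1 hd).eventually_lt_const hneg).filter_mono
        (nhdsWithin_mono t (s := Ioi t) fun _ hs => ne_of_gt hs)
      filter_upwards [hslope, self_mem_nhdsWithin] with s hs hst
      rw [slope_def_field] at hs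
      simp only [Pi.sub_apply, heq, sub_self, sub_zero] at hs
      by_contra! hle
      exact absurd hs (not_lt.2 (div_nonneg (sub_nonneg.2 hle) (sub_nonneg.2 (le_of_lt hst))))

/-- The area decreases and is bounded below. Its loss is the time integral of the dissipation, so
this makes that integral small near `T`. -/
lemma exists_area_sub_le (hab : a < b) (F : IsFlow a b T ρ₀ z r) (hT : 0 < T) {δ : ℝ}
    (hδ : 0 < δ) :
    ∃ s ∈ Ioo 0 T, ∀ t₀ ∈ Ico s T, ∀ t ∈ Ico s T, area a b z r t₀ - area a b z r t ≤ δ := by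
  have hbdd : BddBelow (area a b z r '' Ioo 0 T) :=
    ⟨0, by rintro _ ⟨t, ht, rfl⟩; exact (F.area_pos hab ht).le⟩
  obtain ⟨_, ⟨s, hs, rfl⟩, hlt⟩ := exists_lt_of_csInf_lt ((nonempty_Ioo.2 hT).image _)
    (lt_add_of_pos_right (sInf (area a b z r '' Ioo 0 T)) hδ)
  refine ⟨s, hs, fun t₀ ht₀ t ht => ?_⟩
  have h1 := F.area_antitoneOn hab hs ⟨hs.1.trans_le ht₀.1, ht₀.2⟩ ht₀.1
  have h2 := csInf_le hbdd ⟨t, ⟨hs.1.trans_le ht.1, ht.2⟩, rfl⟩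
  linarith

/-- The radius over `S` is bounded from below by the parabolic scale. -/
lemma exists_le_r_sq (hab : a < b) (F : IsFlow a b T ρ₀ z r) (hT : 0 < T) {κ c : ℝ} (hκ : 0 < κ)
    (hc : 0 < c) {S : Set (Param a b × ℝ)}
    (hS : ∀ P ∈ S, κ * curvP a b z r P.1.1 P.2 ≤ meanCurv a b z r P.1.1 P.2)
    (hy : ∀ P ∈ parabolicBoundary T S, c ≤ r P.1.1 P.2) :
    ∃ s ∈ Ioo 0 T, ∀ t ∈ Ico s T, ∀ m : Param a b, (m, t) ∈ S →
      κ / 16 * (T - t) ≤ r m.1 t ^ 2 := by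
  have hT2 : T / 2 ∈ Ioo 0 T := ⟨by linarith, by linarith⟩
  obtain ⟨c₀, hc₀, hh⟩ := F.exists_avgMeanCurv_le hab hT2
  -- Chosen so that `(16 c₀ / κ) · 2 e = 2 / 3`; the area loss `e / (3 c₀)` below supplies the
  -- remaining third of `μ` in `hinc`.
  set e := κ / (48 * c₀) with he
  have he0 : 0 < e := by positivity
  obtain ⟨s₁, hs₁, hω⟩ := F.exists_area_sub_le hab hT (δ := e / (3 * c₀)) (by positivity)
  -- A violating radius after `T - 16 d² / κ` is below `d`, hence below `e` and with its double
  -- below `c`.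
  set d := min e (c / 2) with hd
  have hd0 : 0 < d := lt_min he0 (by positivity)
  have hs₂ : T - 16 * d ^ 2 / κ < T := by
    have : 0 < 16 * d ^ 2 / κ := by positivity
    linarith
  refine ⟨max (max s₁ (T / 2)) (T - 16 * d ^ 2 / κ),
    ⟨lt_max_of_lt_left (lt_max_of_lt_left hs₁.1), max_lt (max_lt hs₁.2 hT2.2) hs₂⟩,
    fun t₀ ht₀ m₀ hm₀ => ?_⟩
  have hst₁ : s₁ ≤ t₀ := (le_max_left _ _).trans ((le_max_left _ _).trans ht₀.1)
  have hst₂ : T / 2 ≤ t₀ := (le_max_right _ _).trans ((le_max_left _ _).trans ht₀.1)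
  have hst₃ : T - 16 * d ^ 2 / κ ≤ t₀ := (le_max_right _ _).trans ht₀.1
  have ht₀0 : 0 < t₀ := hT2.1.trans_le hst₂
  by_contra! hlt
  set μ := r m₀.1 t₀ with hμ
  have hμ0 : 0 < μ := F.r_pos _ m₀.1.2 _ ⟨ht₀0.le, ht₀.2⟩
  have hμd : μ < d := by
    have h1 : κ / 16 * (T - t₀) ≤ d ^ 2 := by
      have : T - t₀ ≤ 16 * d ^ 2 / κ := by linarith
      calc κ / 16 * (T - t₀) ≤ κ / 16 * (16 * d ^ 2 / κ) := by gcongr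
        _ = d ^ 2 := by field_simp
    exact lt_of_pow_lt_pow_left₀ 2 hd0.le (hlt.trans_le h1)
  have hμe : μ < e := hμd.trans_le (min_le_left _ _)
  have hμc : 2 * μ < c := by linarith [hμd.trans_le (min_le_right e (c / 2))]
  -- Shrinking at rate `κ / (4 μ)` for this time loses `4 μ`, more than the height `2 μ` available;
  -- failure of the claim means exactly `t₀ + τ < T`.
  set τ := 16 * μ ^ 2 / κ with hτ
  have hτ0 : 0 < τ := by positivity
  have hτT : t₀ + τ < T := by
    have : τ < T - t₀ := by
      rw [hτ, div_lt_iff₀ hκ]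
      linarith
    linarith
  have hIco : ∀ t ∈ Icc t₀ (t₀ + τ), t ∈ Ico s₁ T ∧ t ∈ Ico (T / 2) T := fun t ht =>
    ⟨⟨hst₁.trans ht.1, ht.2.trans_lt hτT⟩, ⟨hst₂.trans ht.1, ht.2.trans_lt hτT⟩⟩
  -- Integrated bound of `h` with `η = e / μ`, for which both `η τ` and the area term are
  -- proportional to `μ`.
  have hinc : ∀ t ∈ Icc t₀ (t₀ + τ), c₀ * (1 + e / μ) * (t - t₀) +
      c₀ / (e / μ) * (area a b z r t₀ - area a b z r t) ≤ μ := by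
    intro t ht
    have h1 : c₀ * (1 + e / μ) * (t - t₀) ≤ c₀ * (1 + e / μ) * τ := by
      gcongr
      linarith [ht.2]
    have h2 : c₀ / (e / μ) * (area a b z r t₀ - area a b z r t) ≤
        c₀ / (e / μ) * (e / (3 * c₀)) := by
      gcongr
      exact hω t₀ ⟨hst₁, ht₀.2⟩ t (hIco t ht).1
    have h3 : c₀ / (e / μ) * (e / (3 * c₀)) = μ / 3 := by field_simp
    have h4 : c₀ * (1 + e / μ) * τ = c₀ * 16 / κ * (μ + e) * μ := by rw [hτ]; field_simp
    have h5 : c₀ * 16 / κ * (μ + e) ≤ 2 / 3 := by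
      calc c₀ * 16 / κ * (μ + e) ≤ c₀ * 16 / κ * (e + e) := by gcongr
        _ = 2 / 3 := by rw [he]; field_simp; norm_num
    have h6 : c₀ * 16 / κ * (μ + e) * μ ≤ 2 / 3 * μ := by gcongr
    linarith
  -- The area in `B` makes the dissipation appear in `B'`, where it cancels that in the bound of
  -- `h`. As `B ≤ 2 μ`, the term `κ / B` is at least `κ / (2 μ)`, twice the rate used.
  set B : ℝ → ℝ := fun t => μ + (c₀ * (1 + e / μ) * (t - t₀) +
    c₀ / (e / μ) * (area a b z r t₀ - area a b z r t)) - κ / (4 * μ) * (t - t₀) with hBdef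
  have hB2 : ∀ t ∈ Icc t₀ (t₀ + τ), B t ≤ 2 * μ - κ / (4 * μ) * (t - t₀) := fun t ht => by
    simp only [hBdef]
    linarith [hinc t ht]
  have hB3 : ∀ t ∈ Icc t₀ (t₀ + τ), B t ≤ 2 * μ := fun t ht => by
    have : 0 ≤ κ / (4 * μ) * (t - t₀) := mul_nonneg (by positivity) (sub_nonneg.2 ht.1)
    linarith [hB2 t ht]
  obtain ⟨m, hm, hr⟩ := F.exists_r_le_barrier hS hy ht₀0 hτT (B := B)
    (B' := fun t => c₀ * (1 + e / μ) + c₀ / (e / μ) * dissipation a b z r t - κ / (4 * μ))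
    (fun t ht => by
      have hA := F.hasDerivAt_area hab (t := t) ⟨ht₀0.trans_le ht.1, ht.2.trans_lt hτT⟩
      have hi := (hasDerivAt_id t).sub_const t₀
      refine ((((hi.const_mul (c₀ * (1 + e / μ))).add
        ((hA.const_sub (area a b z r t₀)).const_mul (c₀ / (e / μ)))).const_add μ).sub
          (hi.const_mul (κ / (4 * μ)))).congr_deriv ?_
      ring)
    (fun t ht => (hB3 t ht).trans_lt hμc)
    (fun t ht hpos => by
      have h1 := hh t (hIco t ht).2 (e / μ) (by positivity)
      have h2 : κ / (2 * μ) ≤ κ / B t := by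
        gcongr
        exact hB3 t ht
      have h3 : κ / (4 * μ) < κ / (2 * μ) := by
        gcongr
        norm_num
      have h4 : c₀ * (1 + e / μ + dissipation a b z r t / (e / μ)) =
        c₀ * (1 + e / μ) + c₀ / (e / μ) * dissipation a b z r t := by ring
      linarith)
    hm₀ (by simp [hBdef, hμ]) (t₀ + τ) (right_mem_Icc.2 (by linarith))
  have h1 := F.r_pos _ m.1.2 (t₀ + τ) ⟨by linarith, hτT⟩
  have h2 := hB2 (t₀ + τ) (right_mem_Icc.2 (by linarith))
  have h3 : κ / (4 * μ) * (t₀ + τ - t₀) = 4 * μ := by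
    rw [add_sub_cancel_left, hτ]; field_simp; norm_num
  linarith

lemma continuousOn_normASq (F : IsFlow a b T ρ₀ z r) :
    ContinuousOn (Function.uncurry (normASq a b z r)) (Icc a b ×ˢ Ico 0 T) := by
  have hv : ContinuousOn (Function.uncurry (speed a b z r)) (Icc a b ×ˢ Ico 0 T) :=
    ((F.cont_dz.pow 2).add (F.cont_dr.pow 2)).sqrt
  have hv0 : ∀ P ∈ Icc a b ×ˢ Ico 0 T, Function.uncurry (speed a b z r) P ≠ 0 :=
    fun P hP => (F.speed_pos hP.1 hP.2).ne'
  have hk : ContinuousOn (Function.uncurry (curvK a b z r)) (Icc a b ×ˢ Ico 0 T) :=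
    ((F.cont_ddz.mul F.cont_dr).sub (F.cont_dz.mul F.cont_ddr)).div (hv.pow 3)
      fun P hP => pow_ne_zero 3 (hv0 P hP)
  have hp : ContinuousOn (Function.uncurry (curvP a b z r)) (Icc a b ×ˢ Ico 0 T) :=
    (F.cont_dz.div hv hv0).div F.cont_r fun P hP => (F.r_pos _ hP.1 _ hP.2).ne'
  exact (hk.pow 2).add (hp.pow 2)

/-- Compactness down to time `0`, using that two `l`-derivatives are continuous there. -/
lemma exists_normASq_le (F : IsFlow a b T ρ₀ z r) {s : ℝ} (hs : s < T) :
    ∃ K : ℝ, ∀ t ∈ Icc 0 s, ∀ l ∈ Icc a b, normASq a b z r l t ≤ K := by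
  obtain ⟨K, hK⟩ := (isCompact_Icc.prod isCompact_Icc).exists_bound_of_continuousOn
    (F.continuousOn_normASq.mono (prod_mono (le_refl (Icc a b))
      (fun t (ht : t ∈ Icc 0 s) => ⟨ht.1, ht.2.trans_lt hs⟩)))
  exact ⟨K, fun t ht l hl => (le_abs_self _).trans (hK (l, t) ⟨hl, ht⟩)⟩

end IsFlow
end AxialFlow

/-! ### The curvature bound. -/

theorem proposition6p2
    (a b T : ℝ) (hab : a < b) (hT : 0 < T)
    (ρ₀ : ℝ → ℝ) (hρ₀ : ContDiffOn ℝ ∞ ρ₀ (Icc a b)) (hρ₀_pos : ∀ x ∈ Icc a b, 0 < ρ₀ x)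
    (hρ₀_left : derivWithin ρ₀ (Icc a b) a = 0) (hρ₀_right : derivWithin ρ₀ (Icc a b) b = 0)
    (z r : ℝ → ℝ → ℝ) (hflow : AxialFlow.IsFlow a b T ρ₀ z r)
    (c₂ : ℝ) (hc₂ : 0 < c₂)
    (S : Set (AxialFlow.Param a b × ℝ)) (hS : S ⊆ AxialFlow.hatRegion a b T c₂ z r)
    (c₁₂ c₁₃ : ℝ) (hc₁₂ : 0 < c₁₂) (hc₁₃ : 0 < c₁₃)
    (hA : ∀ P ∈ S, AxialFlow.normASq a b z r P.1.1 P.2 /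
      AxialFlow.meanCurv a b z r P.1.1 P.2 ^ 2 ≤ c₁₂)
    (hy : ∀ P ∈ AxialFlow.parabolicBoundary T S, c₁₃ ≤ r P.1.1 P.2)
    (hsing : AxialFlow.SingularIn a b T z r S) :
    ∃ C : ℝ, 0 < C ∧ ∀ t ∈ Ico 0 T, ∀ m : AxialFlow.Param a b, (m, t) ∈ S →
      AxialFlow.normASq a b z r m.1 t ≤ C / (T - t) := by
  have hH : ∀ P ∈ S, 0 < AxialFlow.meanCurv a b z r P.1.1 P.2 := fun P hP =>
    (half_pos hc₂).trans (hS hP).2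
  -- From `p² ≤ |A|² ≤ c₁₂ H²` and `H > 0`.
  have hκ : ∀ P ∈ S, (1 / Real.sqrt c₁₂) * AxialFlow.curvP a b z r P.1.1 P.2 ≤
      AxialFlow.meanCurv a b z r P.1.1 P.2 := by
    intro P hP
    have h1 := hA P hP
    have h2 := hH P hP
    rw [div_le_iff₀ (by positivity), AxialFlow.normASq] at h1
    rw [one_div_mul_eq_div, div_le_iff₀ (Real.sqrt_pos.2 hc₁₂)]
    refine abs_le_of_sq_le_sq' ?_ (by positivity) |>.2
    rw [mul_pow, Real.sq_sqrt hc₁₂.le]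
    nlinarith [sq_nonneg (AxialFlow.curvK a b z r P.1.1 P.2)]
  have hκ0 : 0 < 1 / Real.sqrt c₁₂ := one_div_pos.2 (Real.sqrt_pos.2 hc₁₂)
  obtain ⟨s, hs, hr⟩ := hflow.exists_le_r_sq hab hT hκ0 hc₁₃ hκ hy
  obtain ⟨K, hK⟩ := hflow.exists_normASq_le hs.2
  obtain ⟨C, hC, hkp⟩ := hflow.exists_curvK_le_mul_curvP hab hs
  set γ := 1 / Real.sqrt c₁₂ / 16 with hγ
  have hγ0 : 0 < γ := by positivity
  -- The first constant serves the times from `s` on, the second those before `s`, where `T - t ≤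
  -- T`.
  refine ⟨max ((C ^ 2 + 1) / γ) (K * T), lt_max_of_lt_left (by positivity), fun t ht m hm => ?_⟩
  have hTt : 0 < T - t := sub_pos.2 ht.2
  rw [le_div_iff₀ hTt]
  rcases le_or_gt s t with hst | hst
  · refine le_trans ?_ (le_max_left _ _)
    have hp := hflow.curvP_pos m.1.2 ht
    have hp1 := hflow.curvP_le m.1.2 ht
    have hrp := hflow.r_pos _ m.1.2 t ht
    have hk1 := hkp t ⟨hst, ht.2⟩ m.1 m.1.2
    have hk2 : 0 < AxialFlow.curvK a b z r m.1 t + AxialFlow.curvP a b z r m.1 t := hH _ hm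
    have hk : AxialFlow.curvK a b z r m.1 t ^ 2 ≤ (C * AxialFlow.curvP a b z r m.1 t) ^ 2 := by
      -- The lower bound is `k > -p ≥ -C p`, from `H > 0` and `C ≥ 1`.
      refine sq_le_sq' ?_ hk1
      nlinarith
    have h1 : AxialFlow.normASq a b z r m.1 t ≤
        (C ^ 2 + 1) * AxialFlow.curvP a b z r m.1 t ^ 2 := by
      rw [AxialFlow.normASq]
      linarith
    have h2 : AxialFlow.curvP a b z r m.1 t ^ 2 ≤ 1 / r m.1 t ^ 2 := by
      rw [← one_div_pow]
      gcongr
    have h3 : T - t ≤ r m.1 t ^ 2 / γ := by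
      rw [le_div_iff₀ hγ0, mul_comm]
      exact hr t ⟨hst, ht.2⟩ m hm
    calc AxialFlow.normASq a b z r m.1 t * (T - t)
        ≤ (C ^ 2 + 1) * (1 / r m.1 t ^ 2) * (r m.1 t ^ 2 / γ) := by gcongr; exact h1.trans (by gcongr)
      _ = (C ^ 2 + 1) / γ := by field_simp
  · refine le_trans ?_ (le_max_right _ _)
    have h1 := hK t ⟨ht.1, hst.le⟩ m.1 m.1.2
    have h0 : 0 ≤ AxialFlow.normASq a b z r m.1 t := by rw [AxialFlow.normASq]; positivity
    exact mul_le_mul h1 (by linarith [ht.1]) hTt.le (h0.trans h1)
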